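/- Smooth manifolds are finite-dimensional, without boundary, Hausdorff and second countable. A Lie groupoid $\mathcal{G}$ has manifolds of objects $X_{\mathcal{G}}$ and of arrows $\mathcal{G}$, source and target $s_{\mathcal{G}},t_{\mathcal{G}}:\mathcal{G}\to X_{\mathcal{G}}$ (smooth submersions), and smooth unit, inversion and product maps, $gh$ being defined when $s_{\mathcal{G}}(g)=t_{\mathcal{G}}(h)$. A right principal $\mathcal{H}$-bundle $(P,\pi,\varepsilon,M)$ over a manifold $M$ is a manifold $P$ with a surjective submersion $\pi:P\to M$, a smooth map $\varepsilon:P\to X_{\mathcal{H}}$ (the momentum) and a smooth right action $(p,h)\mapsto ph$ of $\mathcal{H}$ along $\varepsilon$ (defined for $\varepsilon(p)=t_{\mathcal{H}}(h)$, with $\varepsilon(ph)=s_{\mathcal{H}}(h)$), such that $\pi(ph)=\pi(p)$ and $$\{(p,h)\in P\times\mathcal{H}:\varepsilon(p)=t_{\mathcal{H}}(h)\}\to P\times_M P,\qquad (p,h)\mapsto(p,ph),$$ is a diffeomorphism. Left principal $\mathcal{G}$-bundles are defined in the same way, with a left action along a momentum $J:P\to X_{\mathcal{G}}$ ($gp$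 being defined for $s_{\mathcal{G}}(g)=J(p)$, with $J(gp)=t_{\mathcal{G}}(g)$) and the map $(g,p)\mapsto(gp,p)$. A generalized morphism $P:\mathcal{G}\to\mathcal{H}$ is a right principal $\mathcal{H}$-bundle $(P,\pi,\varepsilon,X_{\mathcal{G}})$ with a smooth left $\mathcal{G}$-action along $\pi$ such that $\varepsilon(gp)=\varepsilon(p)$ and $(gp)h=g(ph)$. It is a Morita equivalence if moreover $(P,\varepsilon,\pi,X_{\mathcal{H}})$ is a left principal $\mathcal{G}$-bundle, with projection $\varepsilon$ and momentum $\pi$. An isomorphism of generalized morphisms from $\mathcal{G}$ to $\mathcal{H}$ is a diffeomorphism of total spaces that respects projections and momenta and is equivariant for both actions. For generalized morphisms $P:\mathcal{G}\to\mathcal{H}$ and $Q:\mathcal{H}\to\mathcal{K}$, the composite $Q\circ P:\mathcal{G}\to\mathcal{K}$ is the quotient manifold $P\times_{\mathcal{H}}Q$ of $\{(p,q)\in P\times Q:\varepsilon_P(p)=\pi_Q(q)\}$ by $(p,q)\sim(ph,h^{-1}q)$, where $t_{\mathcal{H}}(h)=\varepsilon_P(p)$, with projection $[p,q]\mapsto\pi_P(p)$,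 momentum $[p,q]\mapsto\varepsilon_Q(q)$ and actions $g[p,q]=[gp,q]$, $[p,q]k=[p,qk]$. The unit bundle $\mathcal{U}_{\mathcal{G}}:\mathcal{G}\to\mathcal{G}$ is the manifold of arrows $\mathcal{G}$ with projection $t_{\mathcal{G}}$, momentum $s_{\mathcal{G}}$, and $\mathcal{G}$ acting on both sides by multiplication. Theorem. Let $\mathcal{G}$ and $\mathcal{H}$ be Lie groupoids and let $P:\mathcal{G}\to\mathcal{H}$ be a generalized morphism. Then $P$ is a Morita equivalence if and only if there is a generalized morphism $Q:\mathcal{H}\to\mathcal{G}$ such that $Q\circ P$ is isomorphic to $\mathcal{U}_{\mathcal{G}}$ and $P\circ Q$ is isomorphic to $\mathcal{U}_{\mathcal{H}}$, as generalized morphisms. -/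

import Mathlib

universe u

noncomputable section

open scoped Manifold ContDiff Topology
open Set Manifold Topology

namespace HilsumSkandalis

/-- A smooth manifold: finite-dimensional, without boundary, Hausdorff and second countable,
modelled on `ℝ ^ dim`. -/
structure Mfd : Type (u + 1) where
  carrier : Type u
  dim : ℕ
  [topology : TopologicalSpace carrier]
  [charted : ChartedSpace (EuclideanSpace ℝ (Fin dim)) carrier]
  [smooth : IsManifold (𝓡 dim) ∞ carrier]
  [t2 : T2Space carrier]
  [secondCountable : SecondCountableTopology carrier]

instance : CoeSort Mfd.{u} (Type u) := ⟨Mfd.carrier⟩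

attribute [instance] Mfd.topology Mfd.charted Mfd.smooth Mfd.t2 Mfd.secondCountable

/-- The model with corners of a smooth manifold (the identity of `ℝ ^ dim`). -/
abbrev Mfd.I (M : Mfd.{u}) :
    ModelWithCorners ℝ (EuclideanSpace ℝ (Fin M.dim)) (EuclideanSpace ℝ (Fin M.dim)) :=
  𝓡 M.dim

/-- The restriction of `f` is a diffeomorphism from `S` onto `T`. It is used for fibred products
(embedded submanifolds of a product, since one of the two maps is a submersion); on an embedded
submanifold, `ContMDiffOn` is smoothness for the submanifold structure. -/
def IsDiffeoOn {E E' H H' M N : Type*} [NormedAddCommGroup E] [NormedSpace ℝ E]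
    [NormedAddCommGroup E'] [NormedSpace ℝ E'] [TopologicalSpace H] [TopologicalSpace H']
    (I : ModelWithCorners ℝ E H) (J : ModelWithCorners ℝ E' H')
    [TopologicalSpace M] [ChartedSpace H M] [TopologicalSpace N] [ChartedSpace H' N]
    (f : M → N) (S : Set M) (T : Set N) : Prop :=
  ContMDiffOn I J ∞ f S ∧ ∃ g : N → M, ContMDiffOn J I ∞ g T ∧
    MapsTo f S T ∧ MapsTo g T S ∧ LeftInvOn g f S ∧ RightInvOn g f T

/-- A Lie groupoid with manifold of objects `obj`, manifold of arrows `arr`, source `s`, target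
`t`, unit map `unit` and inversion `inv`. The product `mul g h` is meaningful only if
`s g = t h`; its other values are irrelevant and unconstrained. -/
structure LieGroupoid : Type (u + 1) where
  obj : Mfd.{u}
  arr : Mfd.{u}
  s : arr → obj
  t : arr → obj
  unit : obj → arr
  inv : arr → arr
  mul : arr → arr → arr
  s_submersion : IsSubmersion arr.I obj.I ∞ s
  t_submersion : IsSubmersion arr.I obj.I ∞ t
  unit_smooth : ContMDiff obj.I arr.I ∞ unit
  inv_smooth : ContMDiff arr.I arr.I ∞ inv
  mul_smooth : ContMDiffOn (arr.I.prod arr.I) arr.I ∞ (fun z : arr × arr => mul z.1 z.2)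
    {z | s z.1 = t z.2}
  s_unit : ∀ x, s (unit x) = x
  t_unit : ∀ x, t (unit x) = x
  s_inv : ∀ g, s (inv g) = t g
  t_inv : ∀ g, t (inv g) = s g
  s_mul : ∀ g h, s g = t h → s (mul g h) = s h
  t_mul : ∀ g h, s g = t h → t (mul g h) = t g
  mul_assoc : ∀ g h k, s g = t h → s h = t k → mul (mul g h) k = mul g (mul h k)
  unit_mul : ∀ g, mul (unit (t g)) g = g
  mul_unit : ∀ g, mul g (unit (s g)) = g
  inv_mul : ∀ g, mul (inv g) g = unit (s g)
  mul_inv : ∀ g, mul g (inv g) = unit (t g)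

/-- A smooth right action of `H` on `P` with momentum `ε`: `act p h = p h` is meaningful for
`ε p = t h`. -/
structure RightAction (H : LieGroupoid.{u}) (P : Mfd.{u}) (ε : P → H.obj) where
  act : P → H.arr → P
  momentum_smooth : ContMDiff P.I H.obj.I ∞ ε
  act_smooth : ContMDiffOn (P.I.prod H.arr.I) P.I ∞ (fun z : P × H.arr => act z.1 z.2)
    {z | ε z.1 = H.t z.2}
  momentum_act : ∀ p h, ε p = H.t h → ε (act p h) = H.s h
  act_mul : ∀ p h k, ε p = H.t h → H.s h = H.t k → act p (H.mul h k) = act (act p h) k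
  act_unit : ∀ p, act p (H.unit (ε p)) = p

/-- A smooth left action of `G` on `P` with momentum `J`: `act g p = g p` is meaningful for
`s g = J p`. -/
structure LeftAction (G : LieGroupoid.{u}) (P : Mfd.{u}) (J : P → G.obj) where
  act : G.arr → P → P
  momentum_smooth : ContMDiff P.I G.obj.I ∞ J
  act_smooth : ContMDiffOn (G.arr.I.prod P.I) P.I ∞ (fun z : G.arr × P => act z.1 z.2)
    {z | G.s z.1 = J z.2}
  momentum_act : ∀ g p, G.s g = J p → J (act g p) = G.t g
  mul_act : ∀ g k p, G.s g = G.t k → G.s k = J p → act (G.mul g k) p = act g (act k p)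
  unit_act : ∀ p, act (G.unit (J p)) p = p

/-- `(P, π, ε, M)` is a right principal `H`-bundle over `M`. -/
structure IsRightPrincipal {H : LieGroupoid.{u}} {P M : Mfd.{u}} {ε : P → H.obj}
    (π : P → M) (A : RightAction H P ε) : Prop where
  surjective : Function.Surjective π
  submersion : IsSubmersion P.I M.I ∞ π
  invariant : ∀ p h, ε p = H.t h → π (A.act p h) = π p
  diffeo : IsDiffeoOn (P.I.prod H.arr.I) (P.I.prod P.I)
    (fun z : P × H.arr => (z.1, A.act z.1 z.2))
    {z | ε z.1 = H.t z.2} {w : P × P | π w.1 = π w.2}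

/-- `(P, π, J, M)` is a left principal `G`-bundle over `M`. -/
structure IsLeftPrincipal {G : LieGroupoid.{u}} {P M : Mfd.{u}} {J : P → G.obj}
    (π : P → M) (A : LeftAction G P J) : Prop where
  surjective : Function.Surjective π
  submersion : IsSubmersion P.I M.I ∞ π
  invariant : ∀ g p, G.s g = J p → π (A.act g p) = π p
  diffeo : IsDiffeoOn (G.arr.I.prod P.I) (P.I.prod P.I)
    (fun z : G.arr × P => (A.act z.1 z.2, z.2))
    {z | G.s z.1 = J z.2} {w : P × P | π w.1 = π w.2}

/-- A generalized (Hilsum--Skandalis) morphism from `G` to `H`: a right principal `H`-bundle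
`(space, proj, mom)` over the objects of `G` with a left `G`-action along `proj`, which preserves
`mom` and commutes with the right `H`-action. -/
structure GenMorphism (G H : LieGroupoid.{u}) : Type (u + 1) where
  space : Mfd.{u}
  proj : space → G.obj
  mom : space → H.obj
  right : RightAction H space mom
  left : LeftAction G space proj
  principal : IsRightPrincipal proj right
  mom_left : ∀ g p, G.s g = proj p → mom (left.act g p) = mom p
  compat : ∀ g p h, G.s g = proj p → mom p = H.t h →
    right.act (left.act g p) h = left.act g (right.act p h)

/-- `P` is a Morita equivalence: `(space, mom, proj)` is moreover a left principal `G`-bundle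
over the objects of `H`. -/
def GenMorphism.IsMorita {G H : LieGroupoid.{u}} (P : GenMorphism G H) : Prop :=
  IsLeftPrincipal P.mom P.left

/-- Isomorphism of generalized morphisms: a diffeomorphism of the total spaces which respects the
projections and the momenta and is equivariant for both actions. -/
def GenMorphism.Isomorphic {G H : LieGroupoid.{u}} (P P' : GenMorphism G H) : Prop :=
  ∃ τ : Diffeomorph P.space.I P'.space.I P.space P'.space ∞,
    (∀ p, P'.proj (τ p) = P.proj p) ∧ (∀ p, P'.mom (τ p) = P.mom p) ∧
    (∀ p h, P.mom p = H.t h → τ (P.right.act p h) = P'.right.act (τ p) h) ∧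
    (∀ g p, G.s g = P.proj p → τ (P.left.act g p) = P'.left.act g (τ p))

/-- The unit bundle of `G`, as a generalized morphism from `G` to itself: the manifold of arrows
with projection `t`, momentum `s` and the two actions by multiplication. -/
abbrev unitMorphism (G : LieGroupoid.{u}) : GenMorphism G G where
  space := G.arr
  proj := G.t
  mom := G.s
  right :=
    { act := G.mul
      momentum_smooth := G.s_submersion.contMDiff
      act_smooth := G.mul_smooth
      momentum_act := G.s_mul
      act_mul := fun p h k h1 h2 => (G.mul_assoc p h k h1 h2).symm
      act_unit := G.mul_unit }
  left :=
    { act := G.mul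
      momentum_smooth := G.t_submersion.contMDiff
      act_smooth := G.mul_smooth
      momentum_act := G.t_mul
      mul_act := G.mul_assoc
      unit_act := G.unit_mul }
  principal :=
    { surjective := fun x => ⟨G.unit x, G.t_unit x⟩
      submersion := G.t_submersion
      invariant := G.t_mul
      diffeo := by
        refine ⟨contMDiffOn_fst.prodMk G.mul_smooth,
          fun w => (w.1, G.mul (G.inv w.1) w.2), ?_, ?_, ?_, ?_, ?_⟩
        · refine contMDiffOn_fst.prodMk ?_
          refine G.mul_smooth.comp (f := fun w : G.arr × G.arr => (G.inv w.1, w.2))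
            (((G.inv_smooth.comp contMDiff_fst).prodMk contMDiff_snd).contMDiffOn) ?_
          intro w hw
          simpa [G.s_inv] using hw
        · intro z hz
          exact (G.t_mul _ _ hz).symm
        · intro w hw
          have hw' : G.t w.1 = G.t w.2 := hw
          simp [G.t_mul _ _ ((G.s_inv _).trans hw'), G.t_inv]
        · rintro ⟨g, h⟩ hz
          have hz' : G.s g = G.t h := hz
          simp only [Prod.mk.injEq, true_and]
          rw [← G.mul_assoc _ _ _ (G.s_inv g) hz', G.inv_mul, hz', G.unit_mul]
        · rintro ⟨g, h⟩ hw
          have hw' : G.t g = G.t h := hw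
          simp only [Prod.mk.injEq, true_and]
          rw [← G.mul_assoc _ _ _ (G.t_inv g).symm ((G.s_inv g).trans hw'), G.mul_inv, hw',
            G.unit_mul] }
  mom_left := G.s_mul
  compat := fun g p h h1 h2 => G.mul_assoc g p h h1 h2

/-! ### Smooth structures on quotients admitting local slices -/

section Slices

variable {E A N R : Type*} [NormedAddCommGroup E] [NormedSpace ℝ E] [TopologicalSpace A]
  [TopologicalSpace N] [ChartedSpace A N] [TopologicalSpace R]

/-- A local slice for a quotient map `q : S → R`, where `S` is a subset of a manifold `N`: an
invariant map `f` on a saturated open set together with a smooth section `σ`. -/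
structure Slice (I : ModelWithCorners ℝ E A) {S : Set N} (q : S → R) (d : ℕ) where
  T : Set S
  isOpen_T : IsOpen T
  f : N → EuclideanSpace ℝ (Fin d)
  f_smooth : ContMDiffOn I (𝓡 d) ∞ f (Subtype.val '' T)
  V : Set (EuclideanSpace ℝ (Fin d))
  isOpen_V : IsOpen V
  σ : EuclideanSpace ℝ (Fin d) → S
  σ_smooth : ContMDiffOn (𝓡 d) I ∞ (fun e => (σ e : N)) V
  f_mem : ∀ z ∈ T, f z ∈ V
  σ_mem : ∀ e ∈ V, σ e ∈ T
  f_σ : ∀ e ∈ V, f (σ e) = e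
  q_σ : ∀ z ∈ T, q (σ (f z)) = q z
  sat : ∀ z ∈ T, ∀ w, q z = q w → w ∈ T ∧ f z = f w

variable {I : ModelWithCorners ℝ E A} {S : Set N} {q : S → R} {d : ℕ}

/-- The chart of the quotient defined by a local slice. -/
def Slice.chart (D : Slice I q d) (hq : IsQuotientMap q) :
    OpenPartialHomeomorph R (EuclideanSpace ℝ (Fin d)) where
  toFun r := D.f (Function.surjInv hq.surjective r : S)
  invFun e := q (D.σ e)
  source := q '' D.T
  target := D.V
  map_source' := by
    rintro _ ⟨z, hz, rfl⟩
    have := D.sat z hz _ (Function.surjInv_eq hq.surjective (q z)).symm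
    exact D.f_mem _ this.1
  map_target' := fun e he => ⟨_, D.σ_mem e he, rfl⟩
  left_inv' := by
    rintro _ ⟨z, hz, rfl⟩
    have := D.sat z hz _ (Function.surjInv_eq hq.surjective (q z)).symm
    rw [← this.2, D.q_σ z hz]
  right_inv' := by
    intro e he
    have := D.sat _ (D.σ_mem e he) _ (Function.surjInv_eq hq.surjective (q (D.σ e))).symm
    rw [← this.2, D.f_σ e he]
  open_source := by
    rw [← hq.isOpen_preimage]
    convert! D.isOpen_T
    ext w
    exact ⟨fun ⟨z, hz, h⟩ => (D.sat z hz w h).1, fun h => ⟨w, h, rfl⟩⟩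
  open_target := D.isOpen_V
  continuousOn_toFun := by
    have hpre : q ⁻¹' (q '' D.T) = D.T := by
      ext w
      exact ⟨fun ⟨z, hz, h⟩ => (D.sat z hz w h).1, fun h => ⟨w, h, rfl⟩⟩
    have ho : IsOpen (q '' D.T) := by
      rw [← hq.isOpen_preimage, hpre]; exact D.isOpen_T
    rw [hq.continuousOn_isOpen_iff ho, hpre]
    have h1 : ContinuousOn (fun z : S => D.f z) D.T :=
      D.f_smooth.continuousOn.comp continuous_subtype_val.continuousOn (mapsTo_image _ _)
    refine h1.congr ?_
    intro z hz
    exact (D.sat z hz _ (Function.surjInv_eq hq.surjective (q z)).symm).2.symm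
  continuousOn_invFun := by
    refine hq.continuous.comp_continuousOn ?_
    rw [Topology.IsInducing.subtypeVal.continuousOn_iff]
    exact D.σ_smooth.continuousOn

lemma Slice.chart_apply (D : Slice I q d) (hq : IsQuotientMap q) {z : S} (hz : z ∈ D.T) :
    D.chart hq (q z) = D.f z :=
  (D.sat z hz _ (Function.surjInv_eq hq.surjective (q z)).symm).2.symm

/-- The smooth atlas given by a family of local slices. -/
abbrev sliceCharted (hq : IsQuotientMap q) (D : S → Slice I q d)
    (hD : ∀ z, z ∈ (D z).T) : ChartedSpace (EuclideanSpace ℝ (Fin d)) R where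
  atlas := range fun z => (D z).chart hq
  chartAt r := (D (Function.surjInv hq.surjective r)).chart hq
  mem_chart_source _ := ⟨_, hD _, Function.surjInv_eq hq.surjective _⟩
  chart_mem_atlas r := ⟨_, rfl⟩

lemma slice_isManifold (hq : IsQuotientMap q) (D : S → Slice I q d) (hD : ∀ z, z ∈ (D z).T) :
    @IsManifold _ _ _ _ _ _ _ (𝓡 d) ∞ R _ (sliceCharted hq D hD) := by
  let _ := sliceCharted hq D hD
  refine isManifold_of_contDiffOn (𝓡 d) ∞ R ?_
  rintro _ _ ⟨z, rfl⟩ ⟨w, rfl⟩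
  rw [← contMDiffOn_iff_contDiffOn]
  have h : ContMDiffOn (𝓡 d) (𝓡 d) ∞ (fun e => (D w).f ((D z).σ e))
      ((D z).V ∩ {e | (D z).σ e ∈ (D w).T}) :=
    (D w).f_smooth.comp ((D z).σ_smooth.mono inter_subset_left)
      (fun e he => ⟨_, he.2, rfl⟩)
  refine (h.mono ?_).congr ?_
  · rintro e ⟨he, -⟩
    obtain ⟨he1, v, hv, hve⟩ := he
    exact ⟨he1, ((D w).sat v hv _ hve).1⟩
  · rintro e ⟨he, -⟩
    obtain ⟨he1, v, hv, hve⟩ := he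
    exact (D w).chart_apply hq ((D w).sat v hv _ hve).1

open Classical in
/-- Extension of `q : S → R` to the ambient manifold, by a constant. -/
def extendTo (q : S → R) (r₀ : R) (z : N) : R := if h : z ∈ S then q ⟨z, h⟩ else r₀

lemma extendTo_of_mem (r₀ : R) {z : N} (h : z ∈ S) : extendTo q r₀ z = q ⟨z, h⟩ := by
  simp [extendTo, h]

lemma slice_isOpenMap (hq : IsQuotientMap q) (D : S → Slice I q d) (hD : ∀ z, z ∈ (D z).T)
    (hσ : ∀ z : S, (D z).σ ((D z).f z) = z) : IsOpenMap q := by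
  intro B hB
  rw [isOpen_iff_mem_nhds]
  rintro _ ⟨z, hz, rfl⟩
  have hcont : ContinuousOn (fun r => (D z).σ ((D z).chart hq r)) ((D z).chart hq).source := by
    rw [Topology.IsInducing.subtypeVal.continuousOn_iff]
    exact (D z).σ_smooth.continuousOn.comp ((D z).chart hq).continuousOn
      fun r hr => ((D z).chart hq).map_source hr
  refine Filter.mem_of_superset ((hcont.isOpen_inter_preimage
    ((D z).chart hq).open_source hB).mem_nhds ⟨⟨z, hD z, rfl⟩, ?_⟩) ?_
  · rw [mem_preimage, (D z).chart_apply hq (hD z), hσ z]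
    exact hz
  · rintro r ⟨hr, hrB⟩
    exact ⟨_, hrB, ((D z).chart hq).left_inv hr⟩

lemma extendTo_smooth (hq : IsQuotientMap q) (D : S → Slice I q d) (hD : ∀ z, z ∈ (D z).T)
    (r₀ : R) :
    letI := sliceCharted hq D hD
    ContMDiffOn I (𝓡 d) ∞ (extendTo q r₀) S := by
  let _ := sliceCharted hq D hD
  have := slice_isManifold hq D hD
  refine contMDiffOn_of_locally_contMDiffOn ?_
  intro z hz
  obtain ⟨O, hO, hOT⟩ := isOpen_induced_iff.1 (D ⟨z, hz⟩).isOpen_T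
  have hTO : ∀ y (hy : y ∈ S ∩ O), (⟨y, hy.1⟩ : S) ∈ (D ⟨z, hz⟩).T := by
    intro y hy
    rw [← hOT]; exact hy.2
  refine ⟨O, hO, ?_, ?_⟩
  · have := hD ⟨z, hz⟩
    rw [← hOT] at this; exact this
  · have hmax : (D ⟨z, hz⟩).chart hq ∈ IsManifold.maximalAtlas (𝓡 d) ∞ R :=
      IsManifold.subset_maximalAtlas ⟨_, rfl⟩
    have h1 := contMDiffOn_symm_of_mem_maximalAtlas hmax
    have h2 : ContMDiffOn I (𝓡 d) ∞ (D ⟨z, hz⟩).f (S ∩ O) :=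
      (D ⟨z, hz⟩).f_smooth.mono fun y hy => ⟨⟨y, hy.1⟩, hTO y hy, rfl⟩
    refine (h1.comp h2 fun y hy => (D ⟨z, hz⟩).f_mem _ (hTO y hy)).congr ?_
    intro y hy
    rw [extendTo_of_mem r₀ hy.1]
    exact ((D ⟨z, hz⟩).q_σ _ (hTO y hy)).symm

/-- Smooth local sections of the quotient map. -/
lemma exists_localSection (hq : IsQuotientMap q) (D : S → Slice I q d) (hD : ∀ z, z ∈ (D z).T)
    (r₀ : R) :
    letI := sliceCharted hq D hD
    ∃ U : Set R, IsOpen U ∧ r₀ ∈ U ∧ ∃ τ : R → S, ContMDiffOn (𝓡 d) I ∞ (fun r => (τ r : N)) U ∧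
      ∀ r ∈ U, q (τ r) = r := by
  let _ := sliceCharted hq D hD
  have := slice_isManifold hq D hD
  obtain ⟨z, rfl⟩ := hq.surjective r₀
  have hmax : (D z).chart hq ∈ IsManifold.maximalAtlas (𝓡 d) ∞ R :=
    IsManifold.subset_maximalAtlas ⟨_, rfl⟩
  refine ⟨((D z).chart hq).source, ((D z).chart hq).open_source, ⟨z, hD z, rfl⟩,
    fun r => (D z).σ ((D z).chart hq r), ?_, ?_⟩
  · exact (D z).σ_smooth.comp (contMDiffOn_of_mem_maximalAtlas hmax)
      fun r hr => ((D z).chart hq).map_source hr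
  · intro r hr
    exact ((D z).chart hq).left_inv hr

end Slices

/-! ### Local normal form of submersions -/

lemma exists_straightening {M N : Mfd.{u}} {π : M → N} (hπ : IsSubmersion M.I N.I ∞ π) (x₀ : M) :
    ∃ (U : Set M) (W : Set (N × EuclideanSpace ℝ (Fin (M.dim - N.dim))))
      (κ : M → EuclideanSpace ℝ (Fin (M.dim - N.dim)))
      (ψ : N × EuclideanSpace ℝ (Fin (M.dim - N.dim)) → M),
      IsOpen U ∧ x₀ ∈ U ∧ IsOpen W ∧ ContMDiffOn M.I (𝓡 (M.dim - N.dim)) ∞ κ U ∧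
      ContMDiffOn (N.I.prod (𝓡 (M.dim - N.dim))) M.I ∞ ψ W ∧
      (∀ x ∈ U, (π x, κ x) ∈ W ∧ ψ (π x, κ x) = x) ∧
      (∀ w ∈ W, ψ w ∈ U ∧ π (ψ w) = w.1 ∧ κ (ψ w) = w.2) := by
  obtain ⟨F, _, _, hF⟩ := hπ
  have hx₀ := hF x₀
  have L₀ := hx₀.equiv
  have hfin : FiniteDimensional ℝ (EuclideanSpace ℝ (Fin N.dim) × F) :=
    L₀.toLinearEquiv.finiteDimensional
  have hfinF : FiniteDimensional ℝ F :=
    FiniteDimensional.of_surjective (LinearMap.snd ℝ (EuclideanSpace ℝ (Fin N.dim)) F)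
      LinearMap.snd_surjective
  have hrank : Module.finrank ℝ F = M.dim - N.dim := by
    have := L₀.toLinearEquiv.finrank_eq
    rw [Module.finrank_prod] at this
    simp only [finrank_euclideanSpace, Fintype.card_fin] at this
    omega
  have eF : F ≃L[ℝ] EuclideanSpace ℝ (Fin (M.dim - N.dim)) :=
    ContinuousLinearEquiv.ofFinrankEq (by simp [hrank])
  have h := hx₀.trans_F eF
  set a := h.domChart with ha
  set b := h.codChart with hb
  set L := h.equiv with hL
  have hmaps : ∀ x ∈ a.source, π x ∈ b.source := fun x hx => h.source_subset_preimage_source hx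
  have hnf : ∀ x ∈ a.source, b (π x) = (L (a x)).1 := by
    intro x hx
    have hmem : a x ∈ (a.extend (𝓡 M.dim)).target := by simpa using a.map_source hx
    have := h.writtenInCharts hmem
    simpa [← ha, ← hb, ← hL, a.left_inv hx] using this
  have hbs := contMDiffOn_of_mem_maximalAtlas h.codChart_mem_maximalAtlas
  have has := contMDiffOn_of_mem_maximalAtlas h.domChart_mem_maximalAtlas
  have has' := contMDiffOn_symm_of_mem_maximalAtlas h.domChart_mem_maximalAtlas
  have hpair : ContMDiffOn (N.I.prod (𝓡 (M.dim - N.dim))) (𝓡 M.dim) ∞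
      (fun w : N × EuclideanSpace ℝ (Fin (M.dim - N.dim)) => L.symm (b w.1, w.2))
      {w | w.1 ∈ b.source} := by
    have h1 : ContMDiffOn (N.I.prod (𝓡 (M.dim - N.dim))) (𝓡 N.dim) ∞
        (fun w : N × EuclideanSpace ℝ (Fin (M.dim - N.dim)) => b w.1) {w | w.1 ∈ b.source} :=
      hbs.comp contMDiffOn_fst fun w hw => hw
    exact L.symm.contDiff.contMDiff.comp_contMDiffOn (h1.prodMk_space contMDiffOn_snd)
  have hopen : IsOpen {w : N × EuclideanSpace ℝ (Fin (M.dim - N.dim)) | w.1 ∈ b.source} :=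
    b.open_source.preimage continuous_fst
  refine ⟨a.source, {w | w.1 ∈ b.source} ∩ (fun w => L.symm (b w.1, w.2)) ⁻¹' a.target,
    fun x => (L (a x)).2, fun w => a.symm (L.symm (b w.1, w.2)), a.open_source,
    h.mem_domChart_source, hpair.continuousOn.isOpen_inter_preimage hopen a.open_target,
    ?_, ?_, ?_, ?_⟩
  · exact ((ContinuousLinearMap.snd ℝ _ _).comp L.toContinuousLinearMap).contDiff.contMDiff
      |>.comp_contMDiffOn has
  · exact has'.comp (hpair.mono inter_subset_left) fun w hw => hw.2
  · intro x hx
    have e : L.symm (b (π x), (L (a x)).2) = a x := by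
      rw [hnf x hx]; simp
    refine ⟨⟨hmaps x hx, ?_⟩, ?_⟩
    · simpa [e] using a.map_source hx
    · simp only [e, a.left_inv hx]
  · rintro ⟨y, v⟩ ⟨hw1, hw2⟩
    have hs : a.symm (L.symm (b y, v)) ∈ a.source := a.map_target hw2
    refine ⟨hs, b.injOn (hmaps _ hs) hw1 ?_, ?_⟩
    · rw [hnf _ hs, a.right_inv hw2]; simp
    · simp only
      rw [a.right_inv hw2]; simp

lemma exists_section {M N : Mfd.{u}} {π : M → N} (hπ : IsSubmersion M.I N.I ∞ π) (x₀ : M) :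
    ∃ (O : Set N) (σ : N → M), IsOpen O ∧ π x₀ ∈ O ∧ ContMDiffOn N.I M.I ∞ σ O ∧
      σ (π x₀) = x₀ ∧ ∀ y ∈ O, π (σ y) = y := by
  obtain ⟨U, W, κ, ψ, hU, hx, hW, hκ, hψ, h1, h2⟩ := exists_straightening hπ x₀
  have hc : ContMDiff N.I (N.I.prod (𝓡 (M.dim - N.dim))) ∞ fun y : N => (y, κ x₀) :=
    contMDiff_id.prodMk contMDiff_const
  refine ⟨(fun y => (y, κ x₀)) ⁻¹' W, fun y => ψ (y, κ x₀), hW.preimage hc.continuous,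
    (h1 _ hx).1, hψ.comp hc.contMDiffOn fun y hy => hy, (h1 _ hx).2, fun y hy => (h2 _ hy).2.1⟩

/-! ### The division map -/

section Division

variable {H : LieGroupoid.{u}} {P M : Mfd.{u}} {ε : P → H.obj} {π : P → M} {A : RightAction H P ε}

lemma IsRightPrincipal.exists_div (h : IsRightPrincipal π A) :
    ∃ δ : P → P → H.arr,
      ContMDiffOn (P.I.prod P.I) H.arr.I ∞ (fun w : P × P => δ w.1 w.2) {w | π w.1 = π w.2} ∧
      (∀ p q, π p = π q → ε p = H.t (δ p q)) ∧ (∀ p q, π p = π q → A.act p (δ p q) = q) ∧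
      ∀ p k, ε p = H.t k → δ p (A.act p k) = k := by
  obtain ⟨-, g, hg, h1, h2, h3, h4⟩ := h.diffeo
  have h4' : ∀ p q, π p = π q → ((g (p, q)).1, A.act (g (p, q)).1 (g (p, q)).2) = (p, q) :=
    fun p q hpq => h4 (show (p, q) ∈ {w : P × P | π w.1 = π w.2} from hpq)
  have key : ∀ p q, π p = π q → (g (p, q)).1 = p := fun p q hpq => congrArg Prod.fst (h4' p q hpq)
  refine ⟨fun p q => (g (p, q)).2, contMDiff_snd.comp_contMDiffOn hg, ?_, ?_, ?_⟩
  · intro p q hpq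
    have := h2 (show (p, q) ∈ {w : P × P | π w.1 = π w.2} from hpq)
    rwa [mem_ofPred_eq, key p q hpq] at this
  · intro p q hpq
    have := congrArg Prod.snd (h4' p q hpq)
    simpa [key p q hpq] using this
  · intro p k hk
    exact congrArg Prod.snd (h3 (show (p, k) ∈ {z : P × H.arr | ε z.1 = H.t z.2} from hk))

/-- The division map of a principal bundle: `p * div p q = q` for `p`, `q` in the same fibre. -/
def IsRightPrincipal.div (h : IsRightPrincipal π A) : P → P → H.arr := h.exists_div.choose

lemma IsRightPrincipal.div_smooth (h : IsRightPrincipal π A) :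
    ContMDiffOn (P.I.prod P.I) H.arr.I ∞ (fun w : P × P => h.div w.1 w.2) {w | π w.1 = π w.2} :=
  h.exists_div.choose_spec.1

lemma IsRightPrincipal.t_div (h : IsRightPrincipal π A) {p q : P} (hpq : π p = π q) :
    H.t (h.div p q) = ε p :=
  (h.exists_div.choose_spec.2.1 p q hpq).symm

lemma IsRightPrincipal.act_div (h : IsRightPrincipal π A) {p q : P} (hpq : π p = π q) :
    A.act p (h.div p q) = q :=
  h.exists_div.choose_spec.2.2.1 p q hpq

lemma IsRightPrincipal.div_act (h : IsRightPrincipal π A) {p : P} {k : H.arr} (hk : ε p = H.t k) :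
    h.div p (A.act p k) = k :=
  h.exists_div.choose_spec.2.2.2 p k hk

lemma IsRightPrincipal.s_div (h : IsRightPrincipal π A) {p q : P} (hpq : π p = π q) :
    H.s (h.div p q) = ε q := by
  have := A.momentum_act p (h.div p q) (h.t_div hpq).symm
  rw [h.act_div hpq] at this
  exact this.symm

lemma IsRightPrincipal.div_self (h : IsRightPrincipal π A) (p : P) :
    h.div p p = H.unit (ε p) := by
  have := h.div_act (p := p) (k := H.unit (ε p)) (H.t_unit _).symm
  rwa [A.act_unit] at this

lemma IsRightPrincipal.div_act_right (h : IsRightPrincipal π A) {p q : P} {k : H.arr}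
    (hpq : π p = π q) (hk : ε q = H.t k) : h.div p (A.act q k) = H.mul (h.div p q) k := by
  have hs : H.s (h.div p q) = H.t k := (h.s_div hpq).trans hk
  have h1 := h.div_act (p := p) (k := H.mul (h.div p q) k)
    ((h.t_div hpq).symm.trans (H.t_mul _ _ hs).symm)
  rwa [A.act_mul _ _ _ (h.t_div hpq).symm hs, h.act_div hpq] at h1

lemma IsRightPrincipal.act_injective (h : IsRightPrincipal π A) {p : P} {k l : H.arr}
    (hk : ε p = H.t k) (hl : ε p = H.t l) (e : A.act p k = A.act p l) : k = l := by
  rw [← h.div_act hk, e, h.div_act hl]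

end Division

/-! ### Composition of generalized morphisms -/

section Inverses

variable {H : LieGroupoid.{u}} {Q : Mfd.{u}} {J : Q → H.obj} (A : LeftAction H Q J)

lemma LeftAction.inv_act_act {h : H.arr} {x : Q} (e : H.s h = J x) :
    A.act (H.inv h) (A.act h x) = x := by
  rw [← A.mul_act _ _ _ (H.s_inv h) e, H.inv_mul, e, A.unit_act]

lemma LeftAction.act_inv_act {h : H.arr} {x : Q} (e : H.t h = J x) :
    A.act h (A.act (H.inv h) x) = x := by
  rw [← A.mul_act _ _ _ (H.t_inv h).symm ((H.s_inv h).trans e), H.mul_inv, e, A.unit_act]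

end Inverses

section Composite

variable {G H K : LieGroupoid.{u}} (Q : GenMorphism H K) (P : GenMorphism G H)

/-- The fibred product `{(p, x) ∈ P × Q | ε_P p = π_Q x}`. -/
def fibProd : Set (P.space × Q.space) := {z | P.mom z.1 = Q.proj z.2}

/-- `(p, x) ~ (p h, h⁻¹ x)` for `h` in `H` with `t h = ε_P p`. -/
def BalancedRel (z w : fibProd Q P) : Prop :=
  ∃ h : H.arr, H.t h = P.mom z.1.1 ∧
    (P.right.act z.1.1 h, Q.left.act (H.inv h) z.1.2) = w.1

variable {Q P}

lemma balancedRel_iff {z w : fibProd Q P} :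
    BalancedRel Q P z w ↔ P.proj z.1.1 = P.proj w.1.1 ∧
      z.1.2 = Q.left.act (P.principal.div z.1.1 w.1.1) w.1.2 := by
  obtain ⟨⟨p, x⟩, hz⟩ := z
  obtain ⟨⟨p', x'⟩, hw⟩ := w
  have hz' : P.mom p = Q.proj x := hz
  have hw' : P.mom p' = Q.proj x' := hw
  constructor
  · rintro ⟨h, ht, e⟩
    simp only [Prod.mk.injEq] at e
    obtain ⟨rfl, rfl⟩ := e
    refine ⟨(P.principal.invariant _ _ ht.symm).symm, ?_⟩
    simp only
    rw [P.principal.div_act ht.symm, Q.left.act_inv_act (ht.trans hz')]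
  · rintro ⟨e1, e2⟩
    simp only at e1 e2
    refine ⟨P.principal.div p p', P.principal.t_div e1, ?_⟩
    simp only [Prod.mk.injEq]
    refine ⟨P.principal.act_div e1, ?_⟩
    rw [e2, Q.left.inv_act_act ((P.principal.s_div e1).trans hw')]

lemma div_act_div {p p' p'' : P.space} {x : Q.space} (h1 : P.proj p = P.proj p')
    (h2 : P.proj p' = P.proj p'') (hx : P.mom p'' = Q.proj x) :
    Q.left.act (P.principal.div p p') (Q.left.act (P.principal.div p' p'') x) =
      Q.left.act (P.principal.div p p'') x := by
  have hs : H.s (P.principal.div p p') = H.t (P.principal.div p' p'') :=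
    (P.principal.s_div h1).trans (P.principal.t_div h2).symm
  have hm : P.mom p' = H.t (P.principal.div p' p'') := (P.principal.t_div h2).symm
  rw [← Q.left.mul_act _ _ _ hs ((P.principal.s_div h2).trans hx),
    ← P.principal.div_act_right h1 hm, P.principal.act_div h2]

variable (Q P)

/-- The equivalence relation whose quotient is the total space of the composite. -/
def balancedSetoid : Setoid (fibProd Q P) where
  r := BalancedRel Q P
  iseqv :=
    { refl := by
        intro z
        have hz : P.mom z.1.1 = Q.proj z.1.2 := z.2
        rw [balancedRel_iff, P.principal.div_self, hz, Q.left.unit_act]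
        exact ⟨rfl, rfl⟩
      symm := by
        intro z w h
        rw [balancedRel_iff] at h ⊢
        obtain ⟨h1, h2⟩ := h
        have hw : P.mom w.1.1 = Q.proj w.1.2 := w.2
        refine ⟨h1.symm, ?_⟩
        rw [h2, div_act_div h1.symm h1 hw, P.principal.div_self, hw, Q.left.unit_act]
      trans := by
        intro z w v h h'
        rw [balancedRel_iff] at h h' ⊢
        obtain ⟨h1, h2⟩ := h
        obtain ⟨h3, h4⟩ := h'
        refine ⟨h1.trans h3, ?_⟩
        rw [h2, h4, div_act_div h1 h3 v.2] }

/-- The quotient `P ×_H Q`, with the quotient topology. -/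
def CompSpace : Type u := Quotient (balancedSetoid Q P)

instance : TopologicalSpace (CompSpace Q P) :=
  inferInstanceAs (TopologicalSpace (Quotient (balancedSetoid Q P)))

/-- The class `[p, x]`. -/
def compMk : fibProd Q P → CompSpace Q P := Quotient.mk (balancedSetoid Q P)

lemma compMk_isQuotientMap : IsQuotientMap (compMk Q P) := isQuotientMap_quotient_mk'

variable {Q P}

lemma compMk_eq_iff {z w : fibProd Q P} :
    compMk Q P z = compMk Q P w ↔ P.proj z.1.1 = P.proj w.1.1 ∧
      z.1.2 = Q.left.act (P.principal.div z.1.1 w.1.1) w.1.2 := by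
  rw [← balancedRel_iff]
  exact Quotient.eq (r := balancedSetoid Q P)

/-- The second component of the representative of `[p, x]` whose first component is
`σ (π_P p)`. -/
def twist (σ : G.obj → P.space) (z : P.space × Q.space) : Q.space :=
  Q.left.act (P.principal.div (σ (P.proj z.1)) z.1) z.2

lemma proj_twist {σ : G.obj → P.space} {z : P.space × Q.space} (hz : z ∈ fibProd Q P)
    (hσ : P.proj (σ (P.proj z.1)) = P.proj z.1) :
    P.mom (σ (P.proj z.1)) = Q.proj (twist σ z) := by
  rw [twist, Q.left.momentum_act _ _ ((P.principal.s_div hσ).trans hz), P.principal.t_div hσ]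

lemma compMk_twist {σ : G.obj → P.space} {z : fibProd Q P}
    (hσ : P.proj (σ (P.proj z.1.1)) = P.proj z.1.1) :
    compMk Q P ⟨(σ (P.proj z.1.1), twist σ z.1), proj_twist z.2 hσ⟩ = compMk Q P z :=
  compMk_eq_iff.2 ⟨hσ, rfl⟩

lemma twist_eq {σ : G.obj → P.space} {z w : fibProd Q P} (h : compMk Q P z = compMk Q P w)
    (hσ : P.proj (σ (P.proj z.1.1)) = P.proj z.1.1) : twist σ z.1 = twist σ w.1 := by
  obtain ⟨h1, h2⟩ := compMk_eq_iff.1 h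
  rw [twist, twist, h2, div_act_div hσ h1 w.2, h1]

lemma twist_smooth {σ : G.obj → P.space} {O : Set G.obj}
    (hσ : ContMDiffOn G.obj.I P.space.I ∞ σ O) (hσO : ∀ y ∈ O, P.proj (σ y) = y) :
    ContMDiffOn (P.space.I.prod Q.space.I) Q.space.I ∞ (twist (Q := Q) σ)
      (fibProd Q P ∩ {z | P.proj z.1 ∈ O}) := by
  have h0 : ContMDiffOn (P.space.I.prod Q.space.I) P.space.I ∞
      (fun z : P.space × Q.space => σ (P.proj z.1)) (fibProd Q P ∩ {z | P.proj z.1 ∈ O}) :=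
    hσ.comp (P.left.momentum_smooth.comp_contMDiffOn contMDiffOn_fst) fun z hz => hz.2
  have h1 : ContMDiffOn (P.space.I.prod Q.space.I) H.arr.I ∞
      (fun z : P.space × Q.space => P.principal.div (σ (P.proj z.1)) z.1)
      (fibProd Q P ∩ {z | P.proj z.1 ∈ O}) :=
    P.principal.div_smooth.comp (h0.prodMk contMDiffOn_fst) fun z hz => hσO _ hz.2
  exact Q.left.act_smooth.comp (h1.prodMk contMDiffOn_snd) fun z hz =>
    (P.principal.s_div (hσO _ hz.2)).trans hz.1

variable (Q P)

/-- The dimension of the composite. -/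
abbrev compDim {G H K : LieGroupoid.{u}} (Q : GenMorphism H K) (_ : GenMorphism G H) : ℕ :=
  G.obj.dim + (Q.space.dim - H.obj.dim)

/-- A linear splitting of the model space of the composite. -/
def compModel : EuclideanSpace ℝ (Fin (compDim Q P)) ≃L[ℝ]
    EuclideanSpace ℝ (Fin G.obj.dim) × EuclideanSpace ℝ (Fin (Q.space.dim - H.obj.dim)) :=
  ContinuousLinearEquiv.ofFinrankEq (by simp)

lemma exists_slice (z₀ : fibProd Q P) :
    ∃ D : Slice (P.space.I.prod Q.space.I) (compMk Q P) (compDim Q P),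
      z₀ ∈ D.T ∧ D.σ (D.f z₀) = z₀ ∧
      (∀ z ∈ D.T, P.proj z.1.1 ∈ (chartAt (EuclideanSpace ℝ (Fin G.obj.dim))
        (P.proj z₀.1.1)).source) ∧
      (∀ e ∈ D.V, chartAt (EuclideanSpace ℝ (Fin G.obj.dim)) (P.proj z₀.1.1)
        (P.proj (D.σ e).1.1) = (compModel Q P e).1) := by
  obtain ⟨O, σ, hO, hz₀O, hσ, hσz₀, hσO⟩ := exists_section P.principal.submersion z₀.1.1
  obtain ⟨U, W, κ, ψ, hU, hx₀, hW, hκ, hψ, h1, h2⟩ :=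
    exists_straightening Q.principal.submersion z₀.1.2
  set φ := chartAt (EuclideanSpace ℝ (Fin G.obj.dim)) (P.proj z₀.1.1) with hφ
  set Λ := compModel Q P with hΛ
  have hφmax : φ ∈ IsManifold.maximalAtlas G.obj.I ∞ G.obj :=
    IsManifold.chart_mem_maximalAtlas _
  have hφs := contMDiffOn_of_mem_maximalAtlas hφmax
  have hφs' := contMDiffOn_symm_of_mem_maximalAtlas hφmax
  -- the base point of a parameter
  let m : EuclideanSpace ℝ (Fin (compDim Q P)) → G.obj := fun e => φ.symm (Λ e).1
  let y : EuclideanSpace ℝ (Fin (compDim Q P)) →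
      EuclideanSpace ℝ (Fin (Q.space.dim - H.obj.dim)) := fun e => (Λ e).2
  have hfst : ContMDiff (𝓡 (compDim Q P)) (𝓡 G.obj.dim) ∞ (fun e => (Λ e).1) :=
    ((ContinuousLinearMap.fst ℝ _ _).comp Λ.toContinuousLinearMap).contDiff.contMDiff
  have hsnd : ContMDiff (𝓡 (compDim Q P)) (𝓡 (Q.space.dim - H.obj.dim)) ∞ y :=
    ((ContinuousLinearMap.snd ℝ _ _).comp Λ.toContinuousLinearMap).contDiff.contMDiff
  let V₀ : Set (EuclideanSpace ℝ (Fin (compDim Q P))) := (fun e => (Λ e).1) ⁻¹' φ.target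
  have hV₀ : IsOpen V₀ := φ.open_target.preimage hfst.continuous
  have hm : ContMDiffOn (𝓡 (compDim Q P)) G.obj.I ∞ m V₀ :=
    hφs'.comp hfst.contMDiffOn fun e he => he
  let V₁ := V₀ ∩ m ⁻¹' O
  have hV₁ : IsOpen V₁ := hm.continuousOn.isOpen_inter_preimage hV₀ hO
  have hσm : ContMDiffOn (𝓡 (compDim Q P)) P.space.I ∞ (fun e => σ (m e)) V₁ :=
    hσ.comp (hm.mono inter_subset_left) fun e he => he.2
  have hpair : ContMDiffOn (𝓡 (compDim Q P)) (H.obj.I.prod (𝓡 (Q.space.dim - H.obj.dim))) ∞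
      (fun e => (P.mom (σ (m e)), y e)) V₁ :=
    (P.right.momentum_smooth.comp_contMDiffOn hσm).prodMk hsnd.contMDiffOn
  let V := V₁ ∩ (fun e => (P.mom (σ (m e)), y e)) ⁻¹' W
  have hV : IsOpen V := hpair.continuousOn.isOpen_inter_preimage hV₁ hW
  let s : EuclideanSpace ℝ (Fin (compDim Q P)) → P.space × Q.space :=
    fun e => (σ (m e), ψ (P.mom (σ (m e)), y e))
  have hs : ContMDiffOn (𝓡 (compDim Q P)) (P.space.I.prod Q.space.I) ∞ s V :=
    (hσm.mono inter_subset_left).prodMk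
      (hψ.comp (hpair.mono inter_subset_left) fun e he => he.2)
  have hsS : ∀ e ∈ V, s e ∈ fibProd Q P := fun e he => ((h2 _ he.2).2.1).symm
  classical
  let σ' : EuclideanSpace ℝ (Fin (compDim Q P)) → fibProd Q P :=
    fun e => if h : s e ∈ fibProd Q P then ⟨s e, h⟩ else z₀
  have hσ' : ∀ e (he : e ∈ V), σ' e = ⟨s e, hsS e he⟩ := fun e he => dif_pos (hsS e he)
  -- the saturated open set
  have htw := twist_smooth (Q := Q) hσ hσO
  let T₀ : Set (fibProd Q P) := {z | P.proj z.1.1 ∈ O ∩ φ.source}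
  have hT₀ : IsOpen T₀ := (hO.inter φ.open_source).preimage
    (P.left.momentum_smooth.continuous.comp (continuous_fst.comp continuous_subtype_val))
  have htwc : ContinuousOn (fun z : fibProd Q P => twist σ z.1) T₀ :=
    htw.continuousOn.comp continuous_subtype_val.continuousOn fun z hz => ⟨z.2, hz.1⟩
  let T : Set (fibProd Q P) := T₀ ∩ (fun z : fibProd Q P => twist σ z.1) ⁻¹' U
  have hT : IsOpen T := htwc.isOpen_inter_preimage hT₀ hU
  let f : P.space × Q.space → EuclideanSpace ℝ (Fin (compDim Q P)) :=
    fun z => Λ.symm (φ (P.proj z.1), κ (twist σ z))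
  have hf : ContMDiffOn (P.space.I.prod Q.space.I) (𝓡 (compDim Q P)) ∞ f
      (Subtype.val '' T) := by
    have hsub : Subtype.val '' T ⊆ fibProd Q P ∩ {z | P.proj z.1 ∈ O} := by
      rintro _ ⟨z, hz, rfl⟩
      exact ⟨z.2, hz.1.1⟩
    have e1 : ContMDiffOn (P.space.I.prod Q.space.I) (𝓡 G.obj.dim) ∞
        (fun z : P.space × Q.space => φ (P.proj z.1)) (Subtype.val '' T) :=
      hφs.comp (P.left.momentum_smooth.comp_contMDiffOn contMDiffOn_fst) (by
        rintro _ ⟨z, hz, rfl⟩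
        exact hz.1.2)
    have e2 : ContMDiffOn (P.space.I.prod Q.space.I) (𝓡 (Q.space.dim - H.obj.dim)) ∞
        (fun z : P.space × Q.space => κ (twist σ z)) (Subtype.val '' T) :=
      hκ.comp (htw.mono hsub) (by
        rintro _ ⟨z, hz, rfl⟩
        exact hz.2)
    exact Λ.symm.contDiff.contMDiff.comp_contMDiffOn (e1.prodMk_space e2)
  have hmf : ∀ z ∈ T, m (f z.1) = P.proj z.1.1 := by
    intro z hz
    simp only [m, f, ContinuousLinearEquiv.apply_symm_apply]
    exact φ.left_inv hz.1.2
  have hyf : ∀ z : fibProd Q P, y (f z.1) = κ (twist σ z.1) := by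
    intro z
    simp only [y, f, ContinuousLinearEquiv.apply_symm_apply]
  have hmom : ∀ z ∈ T, P.mom (σ (P.proj z.1.1)) = Q.proj (twist σ z.1) := fun z hz =>
    proj_twist z.2 (hσO _ hz.1.1)
  have hfV : ∀ z ∈ T, f z.1 ∈ V := by
    intro z hz
    refine ⟨⟨?_, ?_⟩, ?_⟩
    · simp only [V₀, f, mem_preimage, ContinuousLinearEquiv.apply_symm_apply]
      exact φ.map_source hz.1.2
    · simp only [mem_preimage, hmf z hz]
      exact hz.1.1
    · simp only [mem_preimage, hmf z hz, hyf, hmom z hz]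
      exact (h1 _ hz.2).1
  have hsf : ∀ z ∈ T, s (f z.1) = (σ (P.proj z.1.1), twist σ z.1) := by
    intro z hz
    simp only [s, hmf z hz, hyf, hmom z hz, (h1 _ hz.2).2]
  have hprojs : ∀ e ∈ V, P.proj (s e).1 = m e := fun e he => hσO _ he.1.2
  have htws : ∀ e ∈ V, twist σ (s e) = (s e).2 := by
    intro e he
    have : twist σ (s e) = Q.left.act (P.principal.div (σ (m e)) (σ (m e))) (s e).2 := by
      rw [twist, hprojs e he]
    rw [this, P.principal.div_self]
    have h3 : P.mom (σ (m e)) = Q.proj (s e).2 := hsS e he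
    rw [h3, Q.left.unit_act]
  have hsT : ∀ e (he : e ∈ V), (⟨s e, hsS e he⟩ : fibProd Q P) ∈ T := by
    intro e he
    refine ⟨?_, ?_⟩
    · change P.proj (s e).1 ∈ O ∩ φ.source
      rw [hprojs e he]
      exact ⟨he.1.2, φ.map_target he.1.1⟩
    · change twist σ (s e) ∈ U
      rw [htws e he]
      exact (h2 _ he.2).1
  have hz₀T : z₀ ∈ T := by
    refine ⟨⟨hz₀O, mem_chart_source _ _⟩, ?_⟩
    change twist σ z₀.1 ∈ U
    have h3 : P.mom z₀.1.1 = Q.proj z₀.1.2 := z₀.2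
    rw [twist, hσz₀, P.principal.div_self, h3, Q.left.unit_act]
    exact hx₀
  refine ⟨⟨T, hT, f, hf, V, hV, σ', ?_, hfV, ?_, ?_, ?_, ?_⟩, hz₀T, ?_, fun z hz => hz.1.2, ?_⟩
  · exact hs.congr fun e he => by rw [hσ' e he]
  · intro e he
    rw [hσ' e he]
    exact hsT e he
  · intro e he
    rw [hσ' e he]
    have e1 : φ (P.proj (s e).1) = (Λ e).1 := by
      rw [hprojs e he]
      exact φ.right_inv he.1.1
    have e2 : κ (twist σ (s e)) = (Λ e).2 := by
      rw [htws e he]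
      exact (h2 _ he.2).2.2
    change Λ.symm (φ (P.proj (s e).1), κ (twist σ (s e))) = e
    rw [e1, e2]
    exact Λ.symm_apply_apply e
  · intro z hz
    rw [hσ' _ (hfV z hz)]
    have : (⟨s (f z.1), hsS _ (hfV z hz)⟩ : fibProd Q P) =
        ⟨(σ (P.proj z.1.1), twist σ z.1), proj_twist z.2 (hσO _ hz.1.1)⟩ :=
      Subtype.ext (hsf z hz)
    rw [this]
    exact compMk_twist (hσO _ hz.1.1)
  · intro z hz w hzw
    have e1 : P.proj z.1.1 = P.proj w.1.1 := (compMk_eq_iff.1 hzw).1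
    have e2 : twist σ z.1 = twist σ w.1 := twist_eq hzw (hσO _ hz.1.1)
    refine ⟨⟨?_, ?_⟩, ?_⟩
    · change P.proj w.1.1 ∈ O ∩ φ.source
      rw [← e1]; exact hz.1
    · change twist σ w.1 ∈ U
      rw [← e2]; exact hz.2
    · simp only [f, e1, e2]
  · change σ' (f z₀.1) = z₀
    rw [hσ' _ (hfV z₀ hz₀T)]
    apply Subtype.ext
    change s (f z₀.1) = z₀.1
    rw [hsf z₀ hz₀T]
    have h3 : P.mom z₀.1.1 = Q.proj z₀.1.2 := z₀.2
    rw [twist, hσz₀, P.principal.div_self, h3, Q.left.unit_act]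
  · intro e he
    change φ (P.proj (σ' e).1.1) = (Λ e).1
    rw [hσ' e he]
    change φ (P.proj (s e).1) = (Λ e).1
    rw [hprojs e he]
    exact φ.right_inv he.1.1

/-- A choice of local slices of `P ×_H Q`. -/
def compSlice (z₀ : fibProd Q P) :
    Slice (P.space.I.prod Q.space.I) (compMk Q P) (compDim Q P) :=
  (exists_slice Q P z₀).choose

lemma mem_compSlice (z : fibProd Q P) : z ∈ (compSlice Q P z).T :=
  (exists_slice Q P z).choose_spec.1

lemma compMk_isOpenMap : IsOpenMap (compMk Q P) :=
  slice_isOpenMap (compMk_isQuotientMap Q P) (compSlice Q P) (mem_compSlice Q P)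
    fun z => (exists_slice Q P z).choose_spec.2.1

/-- `[p, x] ↦ π_P p`. -/
def compProj : CompSpace Q P → G.obj :=
  Quotient.lift (fun z : fibProd Q P => P.proj z.1.1) fun z w h =>
    (balancedRel_iff.1 (show BalancedRel Q P z w from h)).1

/-- `[p, x] ↦ ε_Q x`. -/
def compMom : CompSpace Q P → K.obj :=
  Quotient.lift (fun z : fibProd Q P => Q.mom z.1.2) fun z w h => by
    obtain ⟨h1, h2⟩ := balancedRel_iff.1 (show BalancedRel Q P z w from h)
    simp only [h2]
    exact Q.mom_left _ _ ((P.principal.s_div h1).trans w.2)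

@[simp] lemma compProj_mk (z : fibProd Q P) : compProj Q P (compMk Q P z) = P.proj z.1.1 := rfl

@[simp] lemma compMom_mk (z : fibProd Q P) : compMom Q P (compMk Q P z) = Q.mom z.1.2 := rfl

/-- A representative of a class. -/
def compRep (r : CompSpace Q P) : fibProd Q P := Quotient.out r

lemma compMk_rep (r : CompSpace Q P) : compMk Q P (compRep Q P r) = r := Quotient.out_eq r

lemma continuous_compProj : Continuous (compProj Q P) :=
  (compMk_isQuotientMap Q P).continuous_iff.2
    (P.left.momentum_smooth.continuous.comp (continuous_fst.comp continuous_subtype_val))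

instance : SecondCountableTopology (CompSpace Q P) :=
  (compMk_isQuotientMap Q P).secondCountableTopology (compMk_isOpenMap Q P)

instance : T2Space (CompSpace Q P) := by
  refine ⟨fun r r' hne => ?_⟩
  by_cases hpr : compProj Q P r = compProj Q P r'
  · obtain ⟨z, rfl⟩ := (compMk_isQuotientMap Q P).surjective r
    obtain ⟨w, rfl⟩ := (compMk_isQuotientMap Q P).surjective r'
    obtain ⟨O, σ, hO, hzO, hσ, -, hσO⟩ := exists_section P.principal.submersion z.1.1
    have hwO : P.proj w.1.1 ∈ O := by
      simp only [compProj_mk] at hpr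
      rwa [← hpr]
    have hO' : IsOpen (compProj Q P ⁻¹' O) := hO.preimage (continuous_compProj Q P)
    have htw : ∀ v : fibProd Q P, P.proj v.1.1 ∈ O →
        twist σ (compRep Q P (compMk Q P v)).1 = twist σ v.1 := fun v hv =>
      (twist_eq (compMk_rep Q P _).symm (hσO _ hv)).symm
    have hc : ContinuousOn (fun r => twist σ (compRep Q P r).1) (compProj Q P ⁻¹' O) := by
      rw [(compMk_isQuotientMap Q P).continuousOn_isOpen_iff hO']
      refine ContinuousOn.congr (f := fun v : fibProd Q P => twist σ v.1) ?_ fun v hv => htw v hv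
      exact (twist_smooth (Q := Q) hσ hσO).continuousOn.comp
        continuous_subtype_val.continuousOn fun v hv => ⟨v.2, hv⟩
    have hne' : twist σ z.1 ≠ twist σ w.1 := by
      intro e
      apply hne
      rw [← compMk_twist (z := z) (hσO _ hzO), ← compMk_twist (z := w) (hσO _ hwO)]
      congr 1
      apply Subtype.ext
      simp only [compProj_mk] at hpr
      rw [Prod.mk.injEq, hpr]
      exact ⟨rfl, e⟩
    obtain ⟨A, B, hA, hB, hzA, hwB, hAB⟩ := t2_separation hne'
    refine ⟨_, _, hc.isOpen_inter_preimage hO' hA, hc.isOpen_inter_preimage hO' hB,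
      ⟨hzO, ?_⟩, ⟨hwO, ?_⟩, ?_⟩
    · rw [mem_preimage, htw z hzO]; exact hzA
    · rw [mem_preimage, htw w hwO]; exact hwB
    · rw [Set.disjoint_left]
      rintro v ⟨-, hv⟩ ⟨-, hv'⟩
      exact Set.disjoint_left.1 hAB hv hv'
  · exact separated_by_continuous (continuous_compProj Q P) hpr

/-- The smooth structure of `P ×_H Q`, for which the local slices are smooth charts. -/
instance : ChartedSpace (EuclideanSpace ℝ (Fin (compDim Q P))) (CompSpace Q P) :=
  sliceCharted (compMk_isQuotientMap Q P) (compSlice Q P) (mem_compSlice Q P)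

instance : IsManifold (𝓡 (compDim Q P)) ∞ (CompSpace Q P) :=
  slice_isManifold (compMk_isQuotientMap Q P) (compSlice Q P) (mem_compSlice Q P)

/-- The total space of the composite. -/
abbrev compMfd : Mfd.{u} where
  carrier := CompSpace Q P
  dim := compDim Q P

/-- The projection `P ×_{X_H} Q → P ×_H Q` (extended by a constant), between manifolds. -/
def compTo (r₀ : CompSpace Q P) (z : P.space × Q.space) : CompSpace Q P := extendTo (compMk Q P) r₀ z

lemma compTo_of_mem (r₀ : CompSpace Q P) {z : P.space × Q.space} (h : z ∈ fibProd Q P) :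
    compTo Q P r₀ z = compMk Q P ⟨z, h⟩ := extendTo_of_mem r₀ h

lemma compTo_smooth (r₀ : CompSpace Q P) :
    ContMDiffOn (P.space.I.prod Q.space.I) (𝓡 (compDim Q P)) ∞ (compTo Q P r₀) (fibProd Q P) :=
  extendTo_smooth (compMk_isQuotientMap Q P) (compSlice Q P) (mem_compSlice Q P) r₀

lemma exists_compSection (r₀ : CompSpace Q P) :
    ∃ U : Set (CompSpace Q P), IsOpen U ∧ r₀ ∈ U ∧ ∃ τ : CompSpace Q P → fibProd Q P,
      ContMDiffOn (𝓡 (compDim Q P)) (P.space.I.prod Q.space.I) ∞ (fun r => (τ r).1) U ∧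
      ∀ r ∈ U, compMk Q P (τ r) = r :=
  exists_localSection (compMk_isQuotientMap Q P) (compSlice Q P) (mem_compSlice Q P) r₀

/-- `[p, x] k = [p, x k]`. -/
def compRightAct (r : CompSpace Q P) (k : K.arr) : CompSpace Q P :=
  compTo Q P r ((compRep Q P r).1.1, Q.right.act (compRep Q P r).1.2 k)

/-- `g [p, x] = [g p, x]`. -/
def compLeftAct (g : G.arr) (r : CompSpace Q P) : CompSpace Q P :=
  compTo Q P r (P.left.act g (compRep Q P r).1.1, (compRep Q P r).1.2)

variable {Q P}

lemma right_mem {z : P.space × Q.space} (hz : z ∈ fibProd Q P) {k : K.arr}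
    (hk : Q.mom z.2 = K.t k) : (z.1, Q.right.act z.2 k) ∈ fibProd Q P := by
  have h : P.mom z.1 = Q.proj z.2 := hz
  exact h.trans (Q.principal.invariant _ _ hk).symm

lemma left_mem {z : P.space × Q.space} (hz : z ∈ fibProd Q P) {g : G.arr}
    (hg : G.s g = P.proj z.1) : (P.left.act g z.1, z.2) ∈ fibProd Q P := by
  have h : P.mom z.1 = Q.proj z.2 := hz
  exact (P.mom_left _ _ hg).trans h

lemma compRightAct_mk (z : fibProd Q P) {k : K.arr} (hk : Q.mom z.1.2 = K.t k) :
    compRightAct Q P (compMk Q P z) k =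
      compMk Q P ⟨(z.1.1, Q.right.act z.1.2 k), right_mem z.2 hk⟩ := by
  set w := compRep Q P (compMk Q P z) with hw
  have hwz : compMk Q P w = compMk Q P z := compMk_rep Q P _
  have hk' : Q.mom w.1.2 = K.t k := by
    rw [← hk, ← compMom_mk, ← compMom_mk, hwz]
  obtain ⟨h1, h2⟩ := compMk_eq_iff.1 hwz
  have hs : H.s (P.principal.div w.1.1 z.1.1) = Q.proj z.1.2 := (P.principal.s_div h1).trans z.2
  rw [compRightAct, ← hw, compTo_of_mem Q P _ (right_mem w.2 hk')]
  refine compMk_eq_iff.2 ⟨h1, ?_⟩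
  simp only
  rw [← Q.compat _ _ _ hs hk, ← h2]

lemma div_left_act {p p' : P.space} {g : G.arr} (h : P.proj p = P.proj p')
    (hg : G.s g = P.proj p) :
    P.principal.div (P.left.act g p) (P.left.act g p') = P.principal.div p p' := by
  have ht : P.mom p = H.t (P.principal.div p p') := (P.principal.t_div h).symm
  have e : P.left.act g p' = P.right.act (P.left.act g p) (P.principal.div p p') := by
    rw [P.compat _ _ _ hg ht, P.principal.act_div h]
  rw [e, P.principal.div_act ((P.mom_left _ _ hg).trans ht)]

lemma compLeftAct_mk (z : fibProd Q P) {g : G.arr} (hg : G.s g = P.proj z.1.1) :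
    compLeftAct Q P g (compMk Q P z) =
      compMk Q P ⟨(P.left.act g z.1.1, z.1.2), left_mem z.2 hg⟩ := by
  set w := compRep Q P (compMk Q P z) with hw
  have hwz : compMk Q P w = compMk Q P z := compMk_rep Q P _
  obtain ⟨h1, h2⟩ := compMk_eq_iff.1 hwz
  have hg' : G.s g = P.proj w.1.1 := hg.trans h1.symm
  rw [compLeftAct, ← hw, compTo_of_mem Q P _ (left_mem w.2 hg')]
  refine compMk_eq_iff.2 ⟨?_, ?_⟩
  · simp only
    rw [P.left.momentum_act _ _ hg, P.left.momentum_act _ _ hg']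
  · simp only
    rw [div_left_act h1 hg']
    exact h2

variable (Q P)

lemma compProj_smooth : ContMDiff (𝓡 (compDim Q P)) G.obj.I ∞ (compProj Q P) := by
  intro r₀
  obtain ⟨U, hU, hr, τ, hτ, h⟩ := exists_compSection Q P r₀
  refine ContMDiffOn.contMDiffAt (s := U) ?_ (hU.mem_nhds hr)
  refine (P.left.momentum_smooth.comp_contMDiffOn
    (contMDiff_fst.comp_contMDiffOn hτ)).congr fun r hr => ?_
  conv_lhs => rw [← h r hr]
  rfl

lemma compMom_smooth : ContMDiff (𝓡 (compDim Q P)) K.obj.I ∞ (compMom Q P) := by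
  intro r₀
  obtain ⟨U, hU, hr, τ, hτ, h⟩ := exists_compSection Q P r₀
  refine ContMDiffOn.contMDiffAt (s := U) ?_ (hU.mem_nhds hr)
  refine (Q.right.momentum_smooth.comp_contMDiffOn
    (contMDiff_snd.comp_contMDiffOn hτ)).congr fun r hr => ?_
  conv_lhs => rw [← h r hr]
  rfl

/-- The right action of `K` on the composite. -/
def compRight : RightAction K (compMfd Q P) (compMom Q P) where
  act := compRightAct Q P
  momentum_smooth := compMom_smooth Q P
  act_smooth := by
    refine contMDiffOn_of_locally_contMDiffOn ?_
    rintro ⟨r₀, k₀⟩ -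
    obtain ⟨U, hU, hr, τ, hτ, h⟩ := exists_compSection Q P r₀
    refine ⟨Prod.fst ⁻¹' U, hU.preimage continuous_fst, hr, ?_⟩
    have hmem : ∀ z ∈ {z : CompSpace Q P × K.arr | compMom Q P z.1 = K.t z.2} ∩ Prod.fst ⁻¹' U,
        Q.mom (τ z.1).1.2 = K.t z.2 := by
      rintro ⟨r, k⟩ ⟨hz, hzU⟩
      have h1 : compMom Q P r = K.t k := hz
      rw [← h1, ← compMom_mk, h r hzU]
    have hτ' : ContMDiffOn ((𝓡 (compDim Q P)).prod K.arr.I) (P.space.I.prod Q.space.I) ∞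
        (fun z : CompSpace Q P × K.arr => (τ z.1).1)
        ({z : CompSpace Q P × K.arr | compMom Q P z.1 = K.t z.2} ∩ Prod.fst ⁻¹' U) :=
      hτ.comp contMDiffOn_fst fun z hz => hz.2
    have hact : ContMDiffOn ((𝓡 (compDim Q P)).prod K.arr.I) Q.space.I ∞
        (fun z : CompSpace Q P × K.arr => Q.right.act (τ z.1).1.2 z.2)
        ({z : CompSpace Q P × K.arr | compMom Q P z.1 = K.t z.2} ∩ Prod.fst ⁻¹' U) :=
      Q.right.act_smooth.comp ((contMDiff_snd.comp_contMDiffOn hτ').prodMk contMDiffOn_snd) hmem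
    refine ((compTo_smooth Q P r₀).comp ((contMDiff_fst.comp_contMDiffOn hτ').prodMk hact)
      fun z hz => right_mem (τ z.1).2 (hmem z hz)).congr ?_
    intro z hz
    have e := compRightAct_mk (τ z.1) (hmem z hz)
    rw [h _ hz.2] at e
    exact e.trans (compTo_of_mem Q P r₀ (right_mem (τ z.1).2 (hmem z hz))).symm
  momentum_act := by
    intro r k hk
    obtain ⟨z, rfl⟩ := (compMk_isQuotientMap Q P).surjective r
    rw [compRightAct_mk z hk]
    exact Q.right.momentum_act _ _ hk
  act_mul := by
    intro r k l hk hkl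
    obtain ⟨z, rfl⟩ := (compMk_isQuotientMap Q P).surjective r
    have hk1 : Q.mom z.1.2 = K.t k := hk
    have hl : Q.mom (Q.right.act z.1.2 k) = K.t l := (Q.right.momentum_act _ _ hk1).trans hkl
    have hkl' : Q.mom z.1.2 = K.t (K.mul k l) := hk1.trans (K.t_mul _ _ hkl).symm
    rw [compRightAct_mk z hk1, compRightAct_mk z hkl',
      compRightAct_mk ⟨(z.1.1, Q.right.act z.1.2 k), right_mem z.2 hk1⟩ hl]
    congr 1
    apply Subtype.ext
    simp only
    rw [Q.right.act_mul _ _ _ hk1 hkl]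
  act_unit := by
    intro r
    obtain ⟨z, rfl⟩ := (compMk_isQuotientMap Q P).surjective r
    have hk : Q.mom z.1.2 = K.t (K.unit (compMom Q P (compMk Q P z))) := by
      rw [K.t_unit]; rfl
    rw [compRightAct_mk z hk]
    congr 1
    apply Subtype.ext
    simp only [compMom_mk]
    rw [Q.right.act_unit]

/-- The left action of `G` on the composite. -/
def compLeft : LeftAction G (compMfd Q P) (compProj Q P) where
  act := compLeftAct Q P
  momentum_smooth := compProj_smooth Q P
  act_smooth := by
    refine contMDiffOn_of_locally_contMDiffOn ?_
    rintro ⟨g₀, r₀⟩ -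
    obtain ⟨U, hU, hr, τ, hτ, h⟩ := exists_compSection Q P r₀
    refine ⟨Prod.snd ⁻¹' U, hU.preimage continuous_snd, hr, ?_⟩
    have hmem : ∀ z ∈ {z : G.arr × CompSpace Q P | G.s z.1 = compProj Q P z.2} ∩ Prod.snd ⁻¹' U,
        G.s z.1 = P.proj (τ z.2).1.1 := by
      rintro ⟨g, r⟩ ⟨hz, hzU⟩
      have h1 : G.s g = compProj Q P r := hz
      rw [h1, ← compProj_mk, h r hzU]
    have hτ' : ContMDiffOn (G.arr.I.prod (𝓡 (compDim Q P))) (P.space.I.prod Q.space.I) ∞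
        (fun z : G.arr × CompSpace Q P => (τ z.2).1)
        ({z : G.arr × CompSpace Q P | G.s z.1 = compProj Q P z.2} ∩ Prod.snd ⁻¹' U) :=
      hτ.comp contMDiffOn_snd fun z hz => hz.2
    have hact : ContMDiffOn (G.arr.I.prod (𝓡 (compDim Q P))) P.space.I ∞
        (fun z : G.arr × CompSpace Q P => P.left.act z.1 (τ z.2).1.1)
        ({z : G.arr × CompSpace Q P | G.s z.1 = compProj Q P z.2} ∩ Prod.snd ⁻¹' U) :=
      P.left.act_smooth.comp (contMDiffOn_fst.prodMk (contMDiff_fst.comp_contMDiffOn hτ')) hmem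
    refine ((compTo_smooth Q P r₀).comp (hact.prodMk (contMDiff_snd.comp_contMDiffOn hτ'))
      fun z hz => left_mem (τ z.2).2 (hmem z hz)).congr ?_
    intro z hz
    have e := compLeftAct_mk (τ z.2) (hmem z hz)
    rw [h _ hz.2] at e
    exact e.trans (compTo_of_mem Q P r₀ (left_mem (τ z.2).2 (hmem z hz))).symm
  momentum_act := by
    intro g r hg
    obtain ⟨z, rfl⟩ := (compMk_isQuotientMap Q P).surjective r
    rw [compLeftAct_mk z hg]
    exact P.left.momentum_act _ _ hg
  mul_act := by
    intro g k r hgk hk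
    obtain ⟨z, rfl⟩ := (compMk_isQuotientMap Q P).surjective r
    have hk1 : G.s k = P.proj z.1.1 := hk
    have hg : G.s g = P.proj (P.left.act k z.1.1) :=
      hgk.trans (P.left.momentum_act _ _ hk1).symm
    have hgk' : G.s (G.mul g k) = P.proj z.1.1 := (G.s_mul _ _ hgk).trans hk1
    rw [compLeftAct_mk z hk1, compLeftAct_mk z hgk',
      compLeftAct_mk ⟨(P.left.act k z.1.1, z.1.2), left_mem z.2 hk1⟩ hg]
    congr 1
    apply Subtype.ext
    simp only
    rw [P.left.mul_act _ _ _ hgk hk1]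
  unit_act := by
    intro r
    obtain ⟨z, rfl⟩ := (compMk_isQuotientMap Q P).surjective r
    have hk : G.s (G.unit (compProj Q P (compMk Q P z))) = P.proj z.1.1 := by
      rw [G.s_unit]; rfl
    rw [compLeftAct_mk z hk]
    congr 1
    apply Subtype.ext
    simp only [compProj_mk]
    rw [P.left.unit_act]

lemma compProj_submersion : IsSubmersion (𝓡 (compDim Q P)) G.obj.I ∞ (compProj Q P) := by
  refine ⟨EuclideanSpace ℝ (Fin (Q.space.dim - H.obj.dim)), inferInstance, inferInstance,
    fun r => ?_⟩
  obtain ⟨z₀, rfl⟩ := (compMk_isQuotientMap Q P).surjective r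
  have hq := compMk_isQuotientMap Q P
  have hD := (exists_slice Q P z₀).choose_spec
  have hmax : (compSlice Q P z₀).chart hq ∈
      IsManifold.maximalAtlas (𝓡 (compDim Q P)) ∞ (CompSpace Q P) :=
    IsManifold.subset_maximalAtlas ⟨_, rfl⟩
  refine IsSubmersionAtOfComplement.mk_of_charts (compModel Q P)
    ((compSlice Q P z₀).chart hq) (chartAt _ (P.proj z₀.1.1))
    ⟨z₀, mem_compSlice Q P z₀, rfl⟩ (mem_chart_source _ _) hmax
    (IsManifold.chart_mem_maximalAtlas _) ?_ ?_
  · rintro _ ⟨z, hz, rfl⟩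
    exact hD.2.2.1 z hz
  · intro e he
    have he' : e ∈ (compSlice Q P z₀).V := by
      have : e ∈ ((compSlice Q P z₀).chart hq).target := by simpa using he
      exact this
    have e1 := hD.2.2.2 e he'
    simp only [Function.comp_apply, OpenPartialHomeomorph.extend_coe,
      OpenPartialHomeomorph.extend_coe_symm, modelWithCornersSelf_coe,
      modelWithCornersSelf_coe_symm, id_eq]
    exact e1

variable {Q P}

/-- The division map of the composite, on representatives. -/
def repDiv (z w : P.space × Q.space) : K.arr :=
  Q.principal.div z.2 (Q.left.act (P.principal.div z.1 w.1) w.2)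

lemma proj_act_div {z w : P.space × Q.space} (hz : z ∈ fibProd Q P) (hw : w ∈ fibProd Q P)
    (h : P.proj z.1 = P.proj w.1) :
    Q.proj z.2 = Q.proj (Q.left.act (P.principal.div z.1 w.1) w.2) := by
  have hz' : P.mom z.1 = Q.proj z.2 := hz
  rw [Q.left.momentum_act _ _ ((P.principal.s_div h).trans hw), P.principal.t_div h, hz']

lemma t_repDiv {z w : P.space × Q.space} (hz : z ∈ fibProd Q P) (hw : w ∈ fibProd Q P)
    (h : P.proj z.1 = P.proj w.1) : Q.mom z.2 = K.t (repDiv z w) :=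
  (Q.principal.t_div (proj_act_div hz hw h)).symm

lemma compRightAct_repDiv {z w : fibProd Q P} (h : P.proj z.1.1 = P.proj w.1.1) :
    compRightAct Q P (compMk Q P z) (repDiv z.1 w.1) = compMk Q P w := by
  rw [compRightAct_mk z (t_repDiv z.2 w.2 h)]
  refine compMk_eq_iff.2 ⟨h, ?_⟩
  exact Q.principal.act_div (proj_act_div z.2 w.2 h)

lemma compRightAct_injective {r : CompSpace Q P} {k l : K.arr} (hk : compMom Q P r = K.t k)
    (hl : compMom Q P r = K.t l) (e : compRightAct Q P r k = compRightAct Q P r l) : k = l := by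
  obtain ⟨z, rfl⟩ := (compMk_isQuotientMap Q P).surjective r
  rw [compRightAct_mk z hk, compRightAct_mk z hl] at e
  have h2 := (compMk_eq_iff.1 e).2
  have hz : P.mom z.1.1 = Q.proj z.1.2 := z.2
  have hz' : P.mom z.1.1 = Q.proj (Q.right.act z.1.2 l) :=
    hz.trans (Q.principal.invariant _ _ hl).symm
  simp only [P.principal.div_self] at h2
  rw [hz', Q.left.unit_act] at h2
  exact Q.principal.act_injective hk hl h2

lemma repDiv_smooth :
    ContMDiffOn ((P.space.I.prod Q.space.I).prod (P.space.I.prod Q.space.I)) K.arr.I ∞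
      (fun v : (P.space × Q.space) × (P.space × Q.space) => repDiv v.1 v.2)
      {v | v.1 ∈ fibProd Q P ∧ v.2 ∈ fibProd Q P ∧ P.proj v.1.1 = P.proj v.2.1} := by
  have h1 := P.principal.div_smooth.comp (I := (P.space.I.prod Q.space.I).prod
      (P.space.I.prod Q.space.I))
    (f := fun v : (P.space × Q.space) × (P.space × Q.space) => (v.1.1, v.2.1))
    (s := {v | v.1 ∈ fibProd Q P ∧ v.2 ∈ fibProd Q P ∧ P.proj v.1.1 = P.proj v.2.1})
    (((contMDiff_fst.comp contMDiff_fst).prodMk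
      (contMDiff_fst.comp contMDiff_snd)).contMDiffOn) fun v hv => hv.2.2
  have h2 := Q.left.act_smooth.comp
    (h1.prodMk ((contMDiff_snd.comp contMDiff_snd).contMDiffOn))
    fun v hv => (P.principal.s_div hv.2.2).trans hv.2.1
  exact Q.principal.div_smooth.comp
    (((contMDiff_snd.comp contMDiff_fst).contMDiffOn).prodMk h2)
    fun v hv => proj_act_div hv.1 hv.2.1 hv.2.2

variable (Q P)

lemma comp_principal : IsRightPrincipal (compProj Q P) (compRight Q P) where
  surjective := by
    intro x
    obtain ⟨p, rfl⟩ := P.principal.surjective x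
    obtain ⟨y, hy⟩ := Q.principal.surjective (P.mom p)
    exact ⟨compMk Q P ⟨(p, y), hy.symm⟩, rfl⟩
  submersion := compProj_submersion Q P
  invariant := by
    intro r k hk
    obtain ⟨z, rfl⟩ := (compMk_isQuotientMap Q P).surjective r
    change compProj Q P (compRightAct Q P _ k) = _
    rw [compRightAct_mk z hk]
    rfl
  diffeo := by
    have hdiv : ∀ r r' : CompSpace Q P, compProj Q P r = compProj Q P r' →
        compMom Q P r = K.t (repDiv (compRep Q P r).1 (compRep Q P r').1) ∧
        compRightAct Q P r (repDiv (compRep Q P r).1 (compRep Q P r').1) = r' := by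
      intro r r' h
      have h' : P.proj (compRep Q P r).1.1 = P.proj (compRep Q P r').1.1 := by
        rw [← compProj_mk, ← compProj_mk, compMk_rep, compMk_rep, h]
      have e1 := t_repDiv (compRep Q P r).2 (compRep Q P r').2 h'
      have e2 := compRightAct_repDiv h'
      rw [← compMom_mk, compMk_rep] at e1
      rw [compMk_rep, compMk_rep] at e2
      exact ⟨e1, e2⟩
    have hinv : ∀ r k, compMom Q P r = K.t k →
        compProj Q P (compRightAct Q P r k) = compProj Q P r := by
      intro r k hk
      obtain ⟨z, rfl⟩ := (compMk_isQuotientMap Q P).surjective r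
      rw [compRightAct_mk z hk]
      rfl
    refine ⟨contMDiffOn_fst.prodMk (compRight Q P).act_smooth,
      fun w => (w.1, repDiv (compRep Q P w.1).1 (compRep Q P w.2).1), ?_, ?_, ?_, ?_, ?_⟩
    · refine contMDiffOn_fst.prodMk (contMDiffOn_of_locally_contMDiffOn ?_)
      rintro ⟨r₁, r₂⟩ -
      obtain ⟨U₁, hU₁, hr₁, τ₁, hτ₁, h₁⟩ := exists_compSection Q P r₁
      obtain ⟨U₂, hU₂, hr₂, τ₂, hτ₂, h₂⟩ := exists_compSection Q P r₂
      refine ⟨U₁ ×ˢ U₂, hU₁.prod hU₂, ⟨hr₁, hr₂⟩, ?_⟩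
      have hproj : ∀ w ∈ {w : CompSpace Q P × CompSpace Q P | compProj Q P w.1 = compProj Q P w.2} ∩
          U₁ ×ˢ U₂, P.proj (τ₁ w.1).1.1 = P.proj (τ₂ w.2).1.1 := by
        rintro w ⟨hw, hw1, hw2⟩
        rw [← compProj_mk, ← compProj_mk, h₁ _ hw1, h₂ _ hw2]
        exact hw
      have hpair : ContMDiffOn ((𝓡 (compDim Q P)).prod (𝓡 (compDim Q P)))
          ((P.space.I.prod Q.space.I).prod (P.space.I.prod Q.space.I)) ∞
          (fun w : CompSpace Q P × CompSpace Q P => ((τ₁ w.1).1, (τ₂ w.2).1))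
          ({w | compProj Q P w.1 = compProj Q P w.2} ∩ U₁ ×ˢ U₂) :=
        (hτ₁.comp contMDiffOn_fst fun w hw => hw.2.1).prodMk
          (hτ₂.comp contMDiffOn_snd fun w hw => hw.2.2)
      refine (repDiv_smooth.comp hpair fun w hw =>
        ⟨(τ₁ w.1).2, (τ₂ w.2).2, hproj w hw⟩).congr ?_
      intro w hw
      have e1 := t_repDiv (τ₁ w.1).2 (τ₂ w.2).2 (hproj w hw)
      have e2 := compRightAct_repDiv (hproj w hw)
      rw [← compMom_mk, h₁ _ hw.2.1] at e1
      rw [h₁ _ hw.2.1, h₂ _ hw.2.2] at e2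
      obtain ⟨e3, e4⟩ := hdiv w.1 w.2 hw.1
      exact compRightAct_injective e3 e1 (e4.trans e2.symm)
    · intro z hz
      exact (hinv _ _ hz).symm
    · intro w hw
      exact (hdiv _ _ hw).1
    · rintro ⟨r, k⟩ hz
      have hz' : compMom Q P r = K.t k := hz
      obtain ⟨e3, e4⟩ := hdiv r (compRightAct Q P r k) (hinv r k hz').symm
      exact Prod.ext rfl (compRightAct_injective e3 hz' e4)
    · rintro ⟨r, r'⟩ hw
      exact Prod.ext rfl (hdiv r r' hw).2

/-- The composite `Q ∘ P` of generalized morphisms `P : G → H` and `Q : H → K`, with total space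
`P ×_H Q`. -/
abbrev GenMorphism.comp : GenMorphism G K where
  space := compMfd Q P
  proj := compProj Q P
  mom := compMom Q P
  right := compRight Q P
  left := compLeft Q P
  principal := comp_principal Q P
  mom_left := by
    intro g r hg
    obtain ⟨z, rfl⟩ := (compMk_isQuotientMap Q P).surjective r
    change compMom Q P (compLeftAct Q P g _) = _
    rw [compLeftAct_mk z hg]
    rfl
  compat := by
    intro g r k hg hk
    obtain ⟨z, rfl⟩ := (compMk_isQuotientMap Q P).surjective r
    change compRightAct Q P (compLeftAct Q P g _) k = compLeftAct Q P g (compRightAct Q P _ k)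
    have hg' : G.s g = P.proj z.1.1 := hg
    have hk' : Q.mom z.1.2 = K.t k := hk
    rw [compLeftAct_mk z hg', compRightAct_mk z hk',
      compRightAct_mk ⟨(P.left.act g z.1.1, z.1.2), left_mem z.2 hg'⟩ hk',
      compLeftAct_mk ⟨(z.1.1, Q.right.act z.1.2 k), right_mem z.2 hk'⟩ hg']

end Composite

end HilsumSkandalis

end

section

open scoped Manifold ContDiff Topology
open Set Manifold Topology

namespace HilsumSkandalis

/-! If `P` is a Morita equivalence, its inverse is `P` itself with both actions reversed through
inversion, `P.op`. A point of `P.op ∘ P` is a class `[p, p']` with `p`, `p'` in one fibre of the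
momentum, and left principality supplies a unique arrow `g` with `g p' = p`. This division map is a
diffeomorphism onto the arrows of `G`, with inverse `g ↦ [g p, p]` for any `p` over the source of
`g` (`op_comp_isomorphic`). As `P.op` is again Morita and its opposite is `P` (`op_op`), the same
statement for `P.op` gives the other isomorphism.

Conversely, let `Q` be an inverse up to isomorphism. Momenta of composites correspond to source maps
of unit bundles, so both momenta are surjective, and sections of the source map lift to sections of
`P.mom` through every point; hence `P.mom` is a submersion. It remains to divide two points `p`,
`p'` of a fibre of `P.mom`. Choose `q` in `Q` over their common momentum, let `τ` be the isomorphism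
from `Q ∘ P` to the unit bundle of `G`, and put `g = τ[p, q] τ[p', q]⁻¹`. Equivariance and
injectivity of `τ` give `[g p', q] = [p, q]`. The arrow of `H` relating these representatives fixes
`q`, and `H` acts freely on `Q` because `P ∘ Q` is isomorphic to the unit bundle of `H`; so `g p' =
p`. Cancelling `τ[p, q]` shows that `G` acts freely on `P`, so `g` does not depend on `q`, and
letting `q` run along a local section of `Q.proj` shows that `g` is smooth in `(p, p')`.

Since a submersion means a projection in suitable charts, passing from local sections to submersions
takes the inverse function theorem (`isSubmersion_of_localSections`). -/

/-! ### Submersions from local sections -/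

/-- Local normal form, near a point where the derivative has a right inverse, of a smooth map
between finite-dimensional vector spaces. -/
lemma exists_straightening_of_fderiv {E E' F : Type*} [NormedAddCommGroup E] [NormedSpace ℝ E]
    [FiniteDimensional ℝ E] [NormedAddCommGroup E'] [NormedSpace ℝ E'] [FiniteDimensional ℝ E']
    [NormedAddCommGroup F] [NormedSpace ℝ F] [FiniteDimensional ℝ F]
    (hF : Module.finrank ℝ F = Module.finrank ℝ E - Module.finrank ℝ E')
    {f : E → E'} {A : Set E} (hA : IsOpen A) (hf : ContDiffOn ℝ ∞ f A) {a : E} (ha : a ∈ A)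
    {s : E' →L[ℝ] E} (hs : (fderiv ℝ f a).comp s = ContinuousLinearMap.id ℝ E') :
    ∃ (L : E ≃L[ℝ] E' × F) (Θ : OpenPartialHomeomorph E E), a ∈ Θ.source ∧ Θ.source ⊆ A ∧
      ContDiffOn ℝ ∞ Θ Θ.source ∧ ContDiffOn ℝ ∞ Θ.symm Θ.target ∧
      ∀ v ∈ Θ.source, f v = (L (Θ v)).1 := by
  set f' := fderiv ℝ f a with hf'
  have hs' : ∀ w, f' (s w) = w := fun w => DFunLike.congr_fun hs w
  have hsurj : Function.Surjective f' := fun w => ⟨s w, hs' w⟩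
  have hker : Module.finrank ℝ f'.ker = Module.finrank ℝ F := by
    have h1 := f'.toLinearMap.finrank_range_add_finrank_ker
    rw [LinearMap.range_eq_top.2 hsurj, finrank_top] at h1
    rw [hF, ← h1]
    exact (Nat.add_sub_cancel_left _ _).symm
  let e : f'.ker ≃L[ℝ] F := ContinuousLinearEquiv.ofFinrankEq hker
  -- This is the projection onto the kernel of `f'` along the range of `s`; paired with `f'` it
  -- gives a linear isomorphism from `E` to `E' × F`.
  let p₀ : E →L[ℝ] f'.ker := (ContinuousLinearMap.id ℝ E - s.comp f').codRestrict _ fun v => by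
    simp [hs']
  let p : E →L[ℝ] F := e.toContinuousLinearMap.comp p₀
  have hinj : Function.Injective (f'.prod p) := by
    rw [injective_iff_map_eq_zero]
    intro v hv
    have h1 : f' v = 0 := congrArg Prod.fst hv
    have h2 : e (p₀ v) = 0 := congrArg Prod.snd hv
    rw [map_eq_zero_iff e e.injective] at h2
    have h3 : v - s (f' v) = 0 := congrArg Subtype.val h2
    simpa [h1] using h3
  have hdim : Module.finrank ℝ E = Module.finrank ℝ (E' × F) := by
    rw [Module.finrank_prod, hF]
    -- Surjectivity of `f'` ensures that the truncated subtraction in `hF` is a genuine difference.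
    have := LinearMap.finrank_le_finrank_of_surjective (f := f'.toLinearMap) hsurj
    omega
  let L : E ≃L[ℝ] E' × F := (LinearEquiv.ofInjectiveOfFinrankEq
    (f'.prod p).toLinearMap hinj hdim).toContinuousLinearEquiv
  have hL : (L : E →L[ℝ] E' × F) = f'.prod p := by ext v <;> rfl
  -- Composing with `L⁻¹` makes the derivative at `a` the identity, while `L ∘ Ψ = (f, p)` still has
  -- `f` as its first component.
  let Ψ : E → E := fun v => L.symm (f v, p v)
  have hΨ : ContDiffOn ℝ ∞ Ψ A := L.symm.contDiff.comp_contDiffOn (hf.prodMk p.contDiff.contDiffOn)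
  have hΨa : HasFDerivAt Ψ ((ContinuousLinearEquiv.refl ℝ E : E ≃L[ℝ] E) : E →L[ℝ] E) a := by
    have h1 : HasFDerivAt f f' a :=
      ((hf.contDiffAt (hA.mem_nhds ha)).differentiableAt (by simp)).hasFDerivAt
    have h2 := (L.symm : E' × F →L[ℝ] E).hasFDerivAt.comp a (h1.prodMk p.hasFDerivAt)
    convert! h2 using 1
    rw [← hL]
    ext v
    simp
  have hΨat := hΨ.contDiffAt (hA.mem_nhds ha)
  let Θ₀ := hΨat.toOpenPartialHomeomorph Ψ hΨa (by simp)
  -- The local inverse is smooth wherever the derivative of `Ψ` is invertible. This is an open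
  -- condition, so shrinking to `B` makes the inverse smooth on the whole target and not only at the
  -- image of `a`.
  let B : Set E := A ∩ fderiv ℝ Ψ ⁻¹' range ((↑) : (E ≃L[ℝ] E) → E →L[ℝ] E)
  have hB : IsOpen B := (hΨ.continuousOn_fderiv_of_isOpen hA (by simp)).isOpen_inter_preimage hA
    ContinuousLinearEquiv.isOpen
  have haB : a ∈ B := ⟨ha, ContinuousLinearEquiv.refl ℝ E, hΨa.fderiv.symm⟩
  refine ⟨L, Θ₀.restrOpen B hB, ⟨hΨat.mem_toOpenPartialHomeomorph_source hΨa (by simp), haB⟩,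
    fun v hv => hv.2.1, hΨ.mono fun v hv => hv.2.1, ?_, ?_⟩
  · intro v hv
    have hv' := (Θ₀.restrOpen B hB).map_target hv
    obtain ⟨D, hD⟩ := hv'.2.2
    have h1 : ContDiffAt ℝ ∞ Ψ ((Θ₀.restrOpen B hB).symm v) :=
      hΨ.contDiffAt (hA.mem_nhds hv'.2.1)
    refine ((Θ₀.restrOpen B hB).contDiffAt_symm (f₀' := D) hv ?_ h1).contDiffWithinAt
    rw [hD]
    exact (h1.differentiableAt (by simp)).hasFDerivAt
  · intro v hv
    change f v = (L (L.symm (f v, p v))).1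
    simp

/-- A smooth map with smooth local sections through every point is a submersion. -/
lemma isSubmersion_of_localSections {M N : Mfd.{u}} {π : M → N} (hπ : ContMDiff M.I N.I ∞ π)
    (h : ∀ x : M, ∃ (O : Set N) (σ : N → M), IsOpen O ∧ π x ∈ O ∧ ContMDiffOn N.I M.I ∞ σ O ∧
      σ (π x) = x ∧ ∀ y ∈ O, π (σ y) = y) : IsSubmersion M.I N.I ∞ π := by
  refine ⟨EuclideanSpace ℝ (Fin (M.dim - N.dim)), inferInstance, inferInstance, fun x => ?_⟩
  obtain ⟨O, σ, hO, hxO, hσ, hσx, hσO⟩ := h x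
  set a := chartAt (EuclideanSpace ℝ (Fin M.dim)) x
  set b := chartAt (EuclideanSpace ℝ (Fin N.dim)) (π x)
  have hamax : a ∈ IsManifold.maximalAtlas M.I ∞ M := IsManifold.chart_mem_maximalAtlas _
  have hbmax : b ∈ IsManifold.maximalAtlas N.I ∞ N := IsManifold.chart_mem_maximalAtlas _
  have hxa : x ∈ a.source := mem_chart_source _ _
  have hxb : π x ∈ b.source := mem_chart_source _ _
  have ha := contMDiffOn_of_mem_maximalAtlas hamax
  have ha' := contMDiffOn_symm_of_mem_maximalAtlas hamax
  have hb := contMDiffOn_of_mem_maximalAtlas hbmax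
  have hb' := contMDiffOn_symm_of_mem_maximalAtlas hbmax
  let f : EuclideanSpace ℝ (Fin M.dim) → EuclideanSpace ℝ (Fin N.dim) := fun v => b (π (a.symm v))
  let A : Set (EuclideanSpace ℝ (Fin M.dim)) := a.target ∩ (fun v => π (a.symm v)) ⁻¹' b.source
  have hπa := hπ.comp_contMDiffOn ha'
  have hA : IsOpen A := hπa.continuousOn.isOpen_inter_preimage a.open_target b.open_source
  have hf : ContDiffOn ℝ ∞ f A := by
    rw [← contMDiffOn_iff_contDiffOn]
    exact hb.comp (hπa.mono inter_subset_left) fun v hv => hv.2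
  have haxA : a x ∈ A := by
    refine ⟨a.map_source hxa, ?_⟩
    rw [mem_preimage, a.left_inv hxa]
    exact hxb
  -- Differentiating `π ∘ σ = id` in the charts `a` and `b`: the derivative of the section is a
  -- right inverse of the derivative of `f`. Here `σ (π x) = x` is needed for the derivative of `f`
  -- to be taken at `a x`.
  have hsec : ∃ s : EuclideanSpace ℝ (Fin N.dim) →L[ℝ] EuclideanSpace ℝ (Fin M.dim),
      (fderiv ℝ f (a x)).comp s = ContinuousLinearMap.id ℝ _ := by
    let V₁ := b.target ∩ b.symm ⁻¹' O
    have hV₁ : IsOpen V₁ := b.symm.isOpen_inter_preimage hO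
    have hσb : ContMDiffOn (𝓡 N.dim) M.I ∞ (fun w => σ (b.symm w)) V₁ :=
      hσ.comp (hb'.mono inter_subset_left) fun w hw => hw.2
    let V := V₁ ∩ (fun w => σ (b.symm w)) ⁻¹' a.source
    have hV : IsOpen V := hσb.continuousOn.isOpen_inter_preimage hV₁ a.open_source
    have hg : ContDiffOn ℝ ∞ (fun w => a (σ (b.symm w))) V := by
      rw [← contMDiffOn_iff_contDiffOn]
      exact ha.comp (hσb.mono inter_subset_left) fun w hw => hw.2
    have hbx : σ (b.symm (b (π x))) = x := by rw [b.left_inv hxb, hσx]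
    have hbV : b (π x) ∈ V := by
      refine ⟨⟨b.map_source hxb, ?_⟩, ?_⟩
      · rw [mem_preimage, b.left_inv hxb]
        exact hxO
      · rw [mem_preimage, hbx]
        exact hxa
    have hgd : HasFDerivAt (fun w => a (σ (b.symm w))) (fderiv ℝ _ (b (π x))) (b (π x)) :=
      ((hg.contDiffAt (hV.mem_nhds hbV)).differentiableAt (by simp)).hasFDerivAt
    have hfd : HasFDerivAt f (fderiv ℝ f (a x)) (a (σ (b.symm (b (π x))))) := by
      rw [hbx]
      exact ((hf.contDiffAt (hA.mem_nhds haxA)).differentiableAt (by simp)).hasFDerivAt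
    refine ⟨_, (hfd.comp (b (π x)) hgd).unique ((hasFDerivAt_id (b (π x))).congr_of_eventuallyEq ?_)⟩
    filter_upwards [hV.mem_nhds hbV] with w hw
    change b (π (a.symm (a (σ (b.symm w))))) = w
    rw [a.left_inv hw.2, hσO _ hw.1.2, b.right_inv hw.1.1]
  obtain ⟨s, hs⟩ := hsec
  obtain ⟨L, Θ, haΘ, hΘA, hΘ, hΘ', hfΘ⟩ := exists_straightening_of_fderiv
    (F := EuclideanSpace ℝ (Fin (M.dim - N.dim))) (by simp) hA hf haxA hs
  rw [← contMDiffOn_iff_contDiffOn] at hΘ hΘ'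
  refine IsSubmersionAtOfComplement.mk_of_charts L (a ≫ₕ Θ) b ?_ hxb
    ((a ≫ₕ Θ).mem_maximalAtlas_of_contMDiffOn ?_ ?_) hbmax ?_ ?_
  · rw [OpenPartialHomeomorph.trans_source]
    exact ⟨hxa, haΘ⟩
  · rw [OpenPartialHomeomorph.trans_source]
    exact hΘ.comp (ha.mono inter_subset_left) fun y hy => hy.2
  · rw [OpenPartialHomeomorph.trans_target]
    exact ha'.comp (hΘ'.mono inter_subset_left) fun v hv => hv.2
  · rw [OpenPartialHomeomorph.trans_source]
    intro y hy
    have := (hΘA hy.2).2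
    rwa [mem_preimage, a.left_inv hy.1] at this
  · intro v hv
    have hv' : v ∈ Θ.target := by
      have : v ∈ (a ≫ₕ Θ).target := by simpa using hv
      rw [OpenPartialHomeomorph.trans_target] at this
      exact this.1
    have := hfΘ _ (Θ.map_target hv')
    rw [Θ.right_inv hv'] at this
    simpa [f] using this

/-! ### Inversion in a groupoid -/

section Groupoid

variable (G : LieGroupoid.{u})

/-- Cancel `g` by multiplying with `inv g` on the left. The inversion formulas that follow, which
turn reversed actions into actions, are instances of this uniqueness. -/
lemma LieGroupoid.eq_inv_of_mul_eq_unit {g h : G.arr} (hs : G.s g = G.t h)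
    (e : G.mul g h = G.unit (G.t g)) : h = G.inv g := by
  have h1 : G.s h = G.t g := by rw [← G.s_mul _ _ hs, e, G.s_unit]
  have h2 := G.mul_assoc (G.inv g) g h (G.s_inv g) hs
  rw [G.inv_mul, e, hs, G.unit_mul, ← G.s_inv, G.mul_unit] at h2
  exact h2

lemma LieGroupoid.inv_inv (g : G.arr) : G.inv (G.inv g) = g :=
  (G.eq_inv_of_mul_eq_unit (G.s_inv g) (by rw [G.inv_mul, G.t_inv])).symm

lemma LieGroupoid.inv_unit (x : G.obj) : G.inv (G.unit x) = G.unit x :=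
  (G.eq_inv_of_mul_eq_unit (by rw [G.s_unit, G.t_unit]) (by
    simpa only [G.s_unit, G.t_unit] using G.mul_unit (G.unit x))).symm

lemma LieGroupoid.inv_mul_rev {g h : G.arr} (hs : G.s g = G.t h) :
    G.inv (G.mul g h) = G.mul (G.inv h) (G.inv g) := by
  have h1 : G.s (G.inv h) = G.t (G.inv g) := by rw [G.s_inv, G.t_inv, hs]
  refine (G.eq_inv_of_mul_eq_unit ?_ ?_).symm
  · rw [G.s_mul _ _ hs, G.t_mul _ _ h1, G.t_inv]
  · rw [G.t_mul _ _ hs, G.mul_assoc _ _ _ hs (by rw [G.t_mul _ _ h1, G.t_inv]),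
      ← G.mul_assoc h _ _ (G.t_inv h).symm h1, G.mul_inv, ← hs, ← G.t_inv g, G.unit_mul, G.mul_inv]

end Groupoid

section Action

variable {H : LieGroupoid.{u}} {P : Mfd.{u}} {ε : P → H.obj} (A : RightAction H P ε)

lemma RightAction.act_act_inv {p : P} {h : H.arr} (e : ε p = H.t h) :
    A.act (A.act p h) (H.inv h) = p := by
  rw [← A.act_mul _ _ _ e (H.t_inv h).symm, H.mul_inv, ← e, A.act_unit]

end Action

/-! ### The opposite of a Morita equivalence -/

section Opposite

variable {G H : LieGroupoid.{u}}

lemma IsLeftPrincipal.exists_div {P M : Mfd.{u}} {J : P → G.obj} {π : P → M}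
    {A : LeftAction G P J} (h : IsLeftPrincipal π A) :
    ∃ δ : P → P → G.arr,
      ContMDiffOn (P.I.prod P.I) G.arr.I ∞ (fun w : P × P => δ w.1 w.2) {w | π w.1 = π w.2} ∧
      (∀ p q, π p = π q → G.s (δ p q) = J q) ∧ (∀ p q, π p = π q → A.act (δ p q) q = p) ∧
      ∀ k q, G.s k = J q → δ (A.act k q) q = k := by
  obtain ⟨-, g, hg, h1, h2, h3, h4⟩ := h.diffeo
  have h4' : ∀ p q, π p = π q → (A.act (g (p, q)).1 (g (p, q)).2, (g (p, q)).2) = (p, q) :=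
    fun p q hpq => h4 (show (p, q) ∈ {w : P × P | π w.1 = π w.2} from hpq)
  have key : ∀ p q, π p = π q → (g (p, q)).2 = q := fun p q hpq => congrArg Prod.snd (h4' p q hpq)
  refine ⟨fun p q => (g (p, q)).1, contMDiff_fst.comp_contMDiffOn hg, ?_, ?_, ?_⟩
  · intro p q hpq
    have := h2 (show (p, q) ∈ {w : P × P | π w.1 = π w.2} from hpq)
    rwa [mem_ofPred_eq, key p q hpq] at this
  · intro p q hpq
    have := congrArg Prod.fst (h4' p q hpq)
    simpa [key p q hpq] using this
  · intro k q hk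
    exact congrArg Prod.fst (h3 (show (k, q) ∈ {z : G.arr × P | G.s z.1 = J z.2} from hk))

/-- The right action `p g = g⁻¹ p` defined by a left action. -/
def LeftAction.op {P : Mfd.{u}} {J : P → G.obj} (A : LeftAction G P J) : RightAction G P J where
  act p g := A.act (G.inv g) p
  momentum_smooth := A.momentum_smooth
  act_smooth := A.act_smooth.comp (f := fun z : P × G.arr => (G.inv z.2, z.1))
    (((G.inv_smooth.comp contMDiff_snd).prodMk contMDiff_fst).contMDiffOn) fun z hz =>
      (G.s_inv _).trans (Eq.symm hz)
  momentum_act p g hg := by rw [A.momentum_act _ _ ((G.s_inv g).trans hg.symm), G.t_inv]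
  act_mul p g k hg hk := by
    rw [G.inv_mul_rev hk, A.mul_act _ _ _ (by rw [G.s_inv, G.t_inv, hk])
      ((G.s_inv g).trans hg.symm)]
  act_unit p := by rw [G.inv_unit, A.unit_act]

/-- The left action `h p = p h⁻¹` defined by a right action. -/
def RightAction.op {P : Mfd.{u}} {ε : P → H.obj} (A : RightAction H P ε) : LeftAction H P ε where
  act h p := A.act p (H.inv h)
  momentum_smooth := A.momentum_smooth
  act_smooth := A.act_smooth.comp (f := fun z : H.arr × P => (z.2, H.inv z.1))
    ((contMDiff_snd.prodMk (H.inv_smooth.comp contMDiff_fst)).contMDiffOn) fun z hz =>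
      (Eq.symm hz).trans (H.t_inv _).symm
  momentum_act h p hh := by rw [A.momentum_act _ _ (hh.symm.trans (H.t_inv h).symm), H.s_inv]
  mul_act h k p hk hp := by
    rw [H.inv_mul_rev hk, A.act_mul _ _ _ (hp.symm.trans (H.t_inv k).symm)
      (by rw [H.s_inv, H.t_inv, hk])]
  unit_act p := by rw [H.inv_unit, A.act_unit]

/-- The opposite of a Morita equivalence: the same manifold with both actions reversed. -/
def GenMorphism.op (P : GenMorphism G H) (hP : P.IsMorita) : GenMorphism H G where
  space := P.space
  proj := P.mom
  mom := P.proj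
  right := P.left.op
  left := P.right.op
  principal :=
    { surjective := hP.surjective
      submersion := hP.submersion
      invariant := fun p g hg => hP.invariant _ _ ((G.s_inv g).trans hg.symm)
      diffeo := by
        obtain ⟨δ, hδ, h1, h2, h3⟩ := IsLeftPrincipal.exists_div hP
        have ht : ∀ p q, P.mom p = P.mom q → P.proj p = G.t (δ p q) := by
          intro p q hpq
          rw [← P.left.momentum_act _ _ (h1 p q hpq), h2 p q hpq]
        -- As `δ p q` carries `q` to `p`, its inverse carries `p` to `q`, and for the reversed
        -- action this reads `p (δ p q) = q`. So the left division map serves unchanged as the right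
        -- division map of the opposite.
        refine ⟨contMDiffOn_fst.prodMk P.left.op.act_smooth, fun w => (w.1, δ w.1 w.2),
          contMDiffOn_fst.prodMk hδ, ?_, ?_, ?_, ?_⟩
        · intro z hz
          exact (hP.invariant _ _ ((G.s_inv _).trans (Eq.symm hz))).symm
        · intro w hw
          exact ht _ _ hw
        · rintro ⟨p, g⟩ hz
          have hz' : P.proj p = G.t g := hz
          have hs : G.s g = P.proj (P.left.act (G.inv g) p) := by
            rw [P.left.momentum_act _ _ ((G.s_inv g).trans hz'.symm), G.t_inv]
          have := h3 g _ hs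
          rw [P.left.act_inv_act hz'.symm] at this
          exact Prod.ext rfl this
        · rintro ⟨p, q⟩ hw
          refine Prod.ext rfl ?_
          change P.left.act (G.inv (δ p q)) p = q
          have := P.left.inv_act_act (h1 p q hw)
          rwa [h2 p q hw] at this }
  mom_left := fun h p hh => P.principal.invariant _ _ (hh.symm.trans (H.t_inv h).symm)
  compat := fun h p g hh hg =>
    (P.compat _ _ _ ((G.s_inv g).trans hg.symm) (hh.symm.trans (H.t_inv h).symm)).symm

/-- Acting by `h = div q p` in the reversed action is acting by `h⁻¹` on the right, which takes `p =
q h` back to `q`; so the right division map, with its arguments in this order, is the left one. This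
is what makes the opposite Morita. -/
lemma GenMorphism.isLeftPrincipal_op (P : GenMorphism G H) :
    IsLeftPrincipal P.proj P.right.op where
  surjective := P.principal.surjective
  submersion := P.principal.submersion
  invariant h p hh := P.principal.invariant _ _ (Eq.trans (Eq.symm hh) (H.t_inv h).symm)
  diffeo := by
    refine ⟨P.right.op.act_smooth.prodMk contMDiffOn_snd, fun w => (P.principal.div w.1 w.2, w.2),
      P.principal.div_smooth.prodMk contMDiffOn_snd, ?_, ?_, ?_, ?_⟩
    · intro z hz
      exact P.principal.invariant _ _ (Eq.trans (Eq.symm hz) (H.t_inv _).symm)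
    · intro w hw
      exact P.principal.s_div hw
    · rintro ⟨h, p⟩ hz
      have hz' : P.mom p = H.t (H.inv h) := Eq.trans (Eq.symm hz) (H.t_inv _).symm
      have hm : P.mom (P.right.act p (H.inv h)) = H.t h := by
        rw [P.right.momentum_act _ _ hz', H.s_inv]
      have := P.principal.div_act hm
      have e := P.right.act_act_inv hz'
      rw [H.inv_inv] at e
      rw [e] at this
      exact Prod.ext this rfl
    · rintro ⟨q, p⟩ hw
      refine Prod.ext ?_ rfl
      have := P.right.act_act_inv (P.principal.t_div hw).symm
      rwa [P.principal.act_div hw] at this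

lemma GenMorphism.op_isMorita (P : GenMorphism G H) (hP : P.IsMorita) : (P.op hP).IsMorita :=
  P.isLeftPrincipal_op

/-- A true equality: only the actions change, by a double inversion, and `inv (inv g) = g` holds for
every arrow, hence also at the irrelevant values of the actions. -/
lemma GenMorphism.op_op (P : GenMorphism G H) (hP : P.IsMorita) :
    (P.op hP).op (P.op_isMorita hP) = P := by
  obtain ⟨space, proj, mom, ⟨ract, _, _, _, _, _⟩, ⟨lact, _, _, _, _, _⟩, _, _, _⟩ := P
  simp only [GenMorphism.op, LeftAction.op, RightAction.op, LieGroupoid.inv_inv]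

/-! ### Morita equivalences are invertible -/

/-- With `q = p h` one has `g q = (g p) h`, and in the opposite `h⁻¹` acts on `p` by giving `p h =
q`. Thus the class `[g p, p]` depends on `g` alone and defines the inverse of the division map. -/
lemma GenMorphism.compMk_op_eq (P : GenMorphism G H) (hP : P.IsMorita) {g : G.arr} {p q : P.space}
    (hp : G.s g = P.proj p) (hq : G.s g = P.proj q) :
    compMk (P.op hP) P ⟨(P.left.act g p, p), P.mom_left _ _ hp⟩ =
      compMk (P.op hP) P ⟨(P.left.act g q, q), P.mom_left _ _ hq⟩ := by
  have hpq : P.proj p = P.proj q := hp.symm.trans hq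
  refine compMk_eq_iff.2 ⟨?_, ?_⟩
  · simp only
    rw [P.left.momentum_act _ _ hp, P.left.momentum_act _ _ hq]
  · simp only
    rw [div_left_act hpq hp]
    change p = P.right.act q (H.inv (P.principal.div p q))
    have := P.right.act_act_inv (P.principal.t_div hpq).symm
    rw [P.principal.act_div hpq] at this
    exact this.symm

lemma GenMorphism.op_comp_isomorphic (P : GenMorphism G H) (hP : P.IsMorita) :
    ((P.op hP).comp P).Isomorphic (unitMorphism G) := by
  obtain ⟨δ, hδ, h1, h2, h3⟩ := IsLeftPrincipal.exists_div hP
  -- the division map on classes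
  have hδfree : ∀ {p q : P.space} {g : G.arr}, G.s g = P.proj q → P.left.act g q = p →
      δ p q = g := by
    rintro p q g hg rfl
    exact h3 g q hg
  have hδmk : ∀ z w : fibProd (P.op hP) P, compMk (P.op hP) P z = compMk (P.op hP) P w →
      δ z.1.1 z.1.2 = δ w.1.1 w.1.2 := by
    rintro ⟨⟨p, p'⟩, hp⟩ w hzw
    obtain ⟨h, ht, e⟩ := balancedRel_iff.2 (compMk_eq_iff.1 hzw)
    have hp' : P.mom p = P.mom p' := hp
    have e1 : P.right.act p h = w.1.1 := congrArg Prod.fst e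
    -- In the opposite, `h⁻¹ p'` means `p' (h⁻¹)⁻¹ = p' h`. Both components are moved by the same
    -- `h`, and the division map is unchanged since `g (p' h) = (g p') h`.
    have e2 : P.right.act p' (H.inv (H.inv h)) = w.1.2 := congrArg Prod.snd e
    rw [H.inv_inv] at e2
    have ht' : P.mom p' = H.t h := hp'.symm.trans (Eq.symm ht)
    simp only
    rw [← e1, ← e2]
    refine (hδfree ?_ ?_).symm
    · rw [h1 _ _ hp', P.principal.invariant _ _ ht']
    · rw [← P.compat _ _ _ (h1 _ _ hp') ht', h2 _ _ hp']
  let f : CompSpace (P.op hP) P → G.arr := fun r =>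
    δ (compRep (P.op hP) P r).1.1 (compRep (P.op hP) P r).1.2
  have hf : ∀ z : fibProd (P.op hP) P, f (compMk (P.op hP) P z) = δ z.1.1 z.1.2 := fun z =>
    hδmk _ _ (compMk_rep (P.op hP) P _)
  let c : G.obj → P.space := Function.surjInv P.principal.surjective
  have hc : ∀ g : G.arr, G.s g = P.proj (c (G.s g)) := fun g =>
    (Function.surjInv_eq P.principal.surjective _).symm
  let k : G.arr → CompSpace (P.op hP) P := fun g =>
    compMk (P.op hP) P ⟨(P.left.act g (c (G.s g)), c (G.s g)), P.mom_left _ _ (hc g)⟩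
  have hk : ∀ {g : G.arr} {p : P.space} (hp : G.s g = P.proj p),
      k g = compMk (P.op hP) P ⟨(P.left.act g p, p), P.mom_left _ _ hp⟩ := fun hp =>
    P.compMk_op_eq hP (hc _) hp
  have hkf : ∀ r, k (f r) = r := by
    intro r
    obtain ⟨z, rfl⟩ := (compMk_isQuotientMap (P.op hP) P).surjective r
    rw [hf, hk (h1 _ _ z.2)]
    congr 1
    exact Subtype.ext (Prod.ext (h2 _ _ z.2) rfl)
  have hfk : ∀ g, f (k g) = g := fun g => by rw [hf]; exact h3 _ _ (hc g)
  have hfs : ContMDiff (𝓡 (compDim (P.op hP) P)) G.arr.I ∞ f := by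
    intro r₀
    obtain ⟨U, hU, hr, τ, hτ, h⟩ := exists_compSection (P.op hP) P r₀
    refine ContMDiffOn.contMDiffAt (s := U) ?_ (hU.mem_nhds hr)
    refine (hδ.comp hτ fun r _ => (τ r).2).congr fun r hr => ?_
    conv_lhs => rw [← h r hr]
    exact hf _
  -- The choice `c` need not be continuous. Since `k g` can be computed from any point over `G.s g`,
  -- it may be replaced near `g₀` by a smooth local section of `P.proj`.
  have hks : ContMDiff G.arr.I (𝓡 (compDim (P.op hP) P)) ∞ k := by
    intro g₀
    obtain ⟨O, σ, hO, hgO, hσ, -, hσO⟩ := exists_section P.principal.submersion (c (G.s g₀))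
    rw [← hc g₀] at hgO
    have hOg : IsOpen (G.s ⁻¹' O) := hO.preimage G.s_submersion.contMDiff.continuous
    refine ContMDiffOn.contMDiffAt (s := G.s ⁻¹' O) ?_ (hOg.mem_nhds hgO)
    have h4 : ContMDiffOn G.arr.I P.space.I ∞ (fun g => σ (G.s g)) (G.s ⁻¹' O) :=
      hσ.comp G.s_submersion.contMDiff.contMDiffOn fun g hg => hg
    have h5 : ContMDiffOn G.arr.I P.space.I ∞ (fun g => P.left.act g (σ (G.s g))) (G.s ⁻¹' O) :=
      P.left.act_smooth.comp (contMDiffOn_id.prodMk h4) fun g hg => (hσO _ hg).symm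
    refine ((compTo_smooth (P.op hP) P (k g₀)).comp (h5.prodMk h4) fun g hg =>
      P.mom_left _ _ (hσO _ hg).symm).congr fun g hg => ?_
    rw [hk (hσO _ hg).symm]
    exact (compTo_of_mem _ _ _ _).symm
  refine ⟨⟨⟨f, k, hkf, hfk⟩, hfs, hks⟩, ?_, ?_, ?_, ?_⟩
  · intro r
    change G.t (f r) = compProj (P.op hP) P r
    obtain ⟨z, rfl⟩ := (compMk_isQuotientMap (P.op hP) P).surjective r
    rw [hf, compProj_mk, ← P.left.momentum_act _ _ (h1 _ _ z.2), h2 _ _ z.2]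
  · intro r
    change G.s (f r) = compMom (P.op hP) P r
    obtain ⟨z, rfl⟩ := (compMk_isQuotientMap (P.op hP) P).surjective r
    rw [hf]
    exact h1 _ _ z.2
  · intro r g hg
    change f (compRightAct (P.op hP) P r g) = G.mul (f r) g
    obtain ⟨z, rfl⟩ := (compMk_isQuotientMap (P.op hP) P).surjective r
    have hg' : P.proj z.1.2 = G.t g := hg
    have hg'' : G.s (G.inv g) = P.proj z.1.2 := (G.s_inv g).trans hg'.symm
    rw [compRightAct_mk z hg, hf, hf]
    have hm : G.s g = P.proj (P.left.act (G.inv g) z.1.2) := by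
      rw [P.left.momentum_act _ _ hg'', G.t_inv]
    have hs : G.s (δ z.1.1 z.1.2) = G.t g := (h1 _ _ z.2).trans hg'
    -- The right action of `g` replaces the second component `p'` by `g⁻¹ p'`, and `(δ p p') g`
    -- carries `g⁻¹ p'` to `p`.
    refine hδfree (q := P.left.act (G.inv g) z.1.2) ((G.s_mul _ _ hs).trans hm) ?_
    rw [P.left.mul_act _ _ _ hs hm, P.left.act_inv_act hg'.symm, h2 _ _ z.2]
  · intro g r hg
    change f (compLeftAct (P.op hP) P g r) = G.mul g (f r)
    obtain ⟨z, rfl⟩ := (compMk_isQuotientMap (P.op hP) P).surjective r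
    have hg' : G.s g = P.proj z.1.1 := hg
    rw [compLeftAct_mk z hg', hf, hf]
    have hs : G.s g = G.t (δ z.1.1 z.1.2) := by
      rw [← P.left.momentum_act _ _ (h1 _ _ z.2), h2 _ _ z.2, hg']
    refine hδfree ((G.s_mul _ _ hs).trans (h1 _ _ z.2)) ?_
    rw [P.left.mul_act _ _ _ hs (h1 _ _ z.2), h2 _ _ z.2]

end Opposite

/-! ### Invertible generalized morphisms are Morita equivalences -/

section Invertible

variable {G H K : LieGroupoid.{u}}

/-- Smooth local sections of the projection `P ×_{X_H} Q → P ×_H Q` through a given point. -/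
lemma exists_compSection_through (Q : GenMorphism H K) (P : GenMorphism G H) (z : fibProd Q P) :
    ∃ U : Set (CompSpace Q P), IsOpen U ∧ compMk Q P z ∈ U ∧ ∃ τ : CompSpace Q P → fibProd Q P,
      ContMDiffOn (𝓡 (compDim Q P)) (P.space.I.prod Q.space.I) ∞ (fun r => (τ r).1) U ∧
      τ (compMk Q P z) = z ∧ ∀ r ∈ U, compMk Q P (τ r) = r := by
  have hq := compMk_isQuotientMap Q P
  have hmax : (compSlice Q P z).chart hq ∈
      IsManifold.maximalAtlas (𝓡 (compDim Q P)) ∞ (CompSpace Q P) :=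
    IsManifold.subset_maximalAtlas ⟨_, rfl⟩
  refine ⟨((compSlice Q P z).chart hq).source, ((compSlice Q P z).chart hq).open_source,
    ⟨z, mem_compSlice Q P z, rfl⟩, fun r => (compSlice Q P z).σ ((compSlice Q P z).chart hq r),
    (compSlice Q P z).σ_smooth.comp (contMDiffOn_of_mem_maximalAtlas hmax)
      fun r hr => ((compSlice Q P z).chart hq).map_source hr, ?_,
    fun r hr => ((compSlice Q P z).chart hq).left_inv hr⟩
  simp only
  rw [Slice.chart_apply _ hq (mem_compSlice Q P z)]
  exact (exists_slice Q P z).choose_spec.2.1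

variable {P : GenMorphism G H} {Q : GenMorphism H G}

/-- The isomorphism turns the momentum `[q, p] ↦ P.mom p` of the composite into the source map of
`H`, which takes the value `y` at the unit of `y`. -/
lemma GenMorphism.mom_surjective_of_isomorphic
    (h : (P.comp Q).Isomorphic (unitMorphism H)) : Function.Surjective P.mom := by
  obtain ⟨τ, -, hm, -, -⟩ := h
  intro y
  obtain ⟨z, hz⟩ := (compMk_isQuotientMap P Q).surjective (τ.symm (H.unit y))
  refine ⟨z.1.2, ?_⟩
  have := hm (compMk P Q z)
  rw [hz, τ.apply_symm_apply] at this
  have h2 : H.s (H.unit y) = compMom P Q (τ.symm (H.unit y)) := this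
  rw [H.s_unit, ← hz, compMom_mk] at h2
  exact h2.symm

/-- Surjectivity of `Q.mom` completes any `p` to a pair `(q, p)` in the fibred product. A local
section of the source map through the image of `[q, p]` is carried to the composite, lifted to the
fibred product through `(q, p)`, and projected to `P`; it is a local section of `P.mom` through `p`.
-/
lemma GenMorphism.mom_submersion_of_isomorphic (hQ : Function.Surjective Q.mom)
    (h : (P.comp Q).Isomorphic (unitMorphism H)) :
    IsSubmersion P.space.I H.obj.I ∞ P.mom := by
  obtain ⟨τ, -, hm, -, -⟩ := h
  refine isSubmersion_of_localSections P.right.momentum_smooth fun p => ?_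
  obtain ⟨q, hq⟩ := hQ (P.proj p)
  let z : fibProd P Q := ⟨(q, p), hq⟩
  obtain ⟨U, hU, hzU, ρ, hρ, hρz, hρU⟩ := exists_compSection_through P Q z
  obtain ⟨O, η, hO, hxO, hη, hηx, hηO⟩ := exists_section H.s_submersion (τ (compMk P Q z))
  have hm' : ∀ r, H.s (τ r) = compMom P Q r := hm
  rw [hm', compMom_mk] at hxO hηx
  have hτη : ContMDiffOn H.obj.I (𝓡 (compDim P Q)) ∞ (fun y => τ.symm (η y)) O :=
    τ.symm.contMDiff.comp_contMDiffOn hη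
  have hx : τ.symm (η (P.mom p)) = compMk P Q z := by
    rw [hηx]
    exact τ.symm_apply_apply _
  refine ⟨O ∩ (fun y => τ.symm (η y)) ⁻¹' U, fun y => (ρ (τ.symm (η y))).1.2,
    hτη.continuousOn.isOpen_inter_preimage hO hU, ⟨hxO, ?_⟩,
    contMDiff_snd.comp_contMDiffOn (hρ.comp (hτη.mono inter_subset_left) fun y hy => hy.2), ?_, ?_⟩
  · rw [mem_preimage, hx]
    exact hzU
  · simp only
    rw [hx, hρz]
  · intro y hy
    rw [← compMom_mk P Q, hρU _ hy.2, ← hm', τ.apply_symm_apply, hηO _ hy.1]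

/-- An arrow that fixes `q` fixes every class `[q, p]`; its image in the unit bundle is an arrow
fixed by left multiplication by `k`, and cancelling it leaves a unit. -/
lemma GenMorphism.left_act_free_of_isomorphic (h : (P.comp Q).Isomorphic (unitMorphism H))
    {k : H.arr} {q : Q.space} (hk : H.s k = Q.proj q) (e : Q.left.act k q = q) :
    k = H.unit (Q.proj q) := by
  obtain ⟨τ, hp, -, -, hl⟩ := h
  obtain ⟨p, hp'⟩ := P.principal.surjective (Q.mom q)
  let z : fibProd P Q := ⟨(q, p), hp'.symm⟩
  have h1 : τ (compLeftAct P Q k (compMk P Q z)) = H.mul k (τ (compMk P Q z)) := hl k _ hk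
  have ht : H.t (τ (compMk P Q z)) = Q.proj q := hp _
  have h2 : compLeftAct P Q k (compMk P Q z) = compMk P Q z := by
    rw [compLeftAct_mk z hk]
    congr 1
    exact Subtype.ext (Prod.ext e rfl)
  rw [h2] at h1
  have hs : H.s k = H.t (τ (compMk P Q z)) := hk.trans ht.symm
  have h3 := H.mul_assoc k _ _ hs (H.t_inv (τ (compMk P Q z))).symm
  rw [← h1, H.mul_inv, ht, ← hk, H.mul_unit] at h3
  rw [← h3, hk]

theorem GenMorphism.isMorita_of_isomorphic (h₁ : (Q.comp P).Isomorphic (unitMorphism G))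
    (h₂ : (P.comp Q).Isomorphic (unitMorphism H)) : P.IsMorita := by
  have hQ : Function.Surjective Q.mom := mom_surjective_of_isomorphic h₁
  have hfree : ∀ {k : H.arr} {q : Q.space}, H.s k = Q.proj q → Q.left.act k q = q →
    k = H.unit (Q.proj q) := left_act_free_of_isomorphic h₂
  obtain ⟨τ, hp, hm, -, hl⟩ := h₁
  have hp' : ∀ r, G.t (τ r) = compProj Q P r := hp
  have hm' : ∀ r, G.s (τ r) = compMom Q P r := hm
  have hl' : ∀ g r, G.s g = compProj Q P r → τ (compLeftAct Q P g r) = G.mul g (τ r) := hl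
  -- the quotient of two points of a fibre of `P.mom`, computed with an auxiliary point of `Q`
  have hdiv : ∀ {p p' : P.space} {q : Q.space} (e : P.mom p = Q.proj q) (e' : P.mom p' = Q.proj q),
      G.s (G.mul (τ (compMk Q P ⟨(p, q), e⟩)) (G.inv (τ (compMk Q P ⟨(p', q), e'⟩)))) =
        P.proj p' ∧
      P.left.act (G.mul (τ (compMk Q P ⟨(p, q), e⟩)) (G.inv (τ (compMk Q P ⟨(p', q), e'⟩)))) p' =
        p := by
    intro p p' q e e'
    set a := τ (compMk Q P ⟨(p, q), e⟩)
    set b := τ (compMk Q P ⟨(p', q), e'⟩) with hb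
    have has : G.s a = Q.mom q := hm' _
    have hbs : G.s b = Q.mom q := hm' _
    have hbt : G.t b = P.proj p' := hp' _
    have hab : G.s a = G.t (G.inv b) := by rw [has, G.t_inv, hbs]
    have hs : G.s (G.mul a (G.inv b)) = P.proj p' := by rw [G.s_mul _ _ hab, G.s_inv, hbt]
    refine ⟨hs, ?_⟩
    -- Equivariance gives `τ (a b⁻¹ [p', q]) = a b⁻¹ b = a = τ [p, q]`.
    have h1 := hl' (G.mul a (G.inv b)) (compMk Q P ⟨(p', q), e'⟩) hs
    rw [← hb, G.mul_assoc _ _ _ hab (G.s_inv b), G.inv_mul, hbs, ← has, G.mul_unit,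
      compLeftAct_mk _ hs] at h1
    -- The two classes agree, so some `k` sends `(a b⁻¹ p', q)` to `(p, q)`; as `k⁻¹` fixes `q`,
    -- freeness on `Q` makes `k` a unit.
    obtain ⟨k, hk, e2⟩ := balancedRel_iff.2 (compMk_eq_iff.1 (τ.injective h1))
    have e3 : P.right.act (P.left.act (G.mul a (G.inv b)) p') k = p := congrArg Prod.fst e2
    have e4 : Q.left.act (H.inv k) q = q := congrArg Prod.snd e2
    have hk' : H.t k = P.mom (P.left.act (G.mul a (G.inv b)) p') := hk
    have hkq : H.t k = Q.proj q := by rw [hk', P.mom_left _ _ hs, e']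
    have e5 : k = H.unit (Q.proj q) := by
      rw [← H.inv_inv k, hfree ((H.s_inv k).trans hkq) e4, H.inv_unit]
    rw [e5, ← hkq, hk', P.right.act_unit] at e3
    exact e3
  have hinj : ∀ {g k : G.arr} {p : P.space}, G.s g = P.proj p → G.s k = P.proj p →
      P.left.act g p = P.left.act k p → g = k := by
    intro g k p hg hk e
    obtain ⟨q, hq⟩ := Q.principal.surjective (P.mom p)
    let z : fibProd Q P := ⟨(p, q), hq.symm⟩
    have h1 : compLeftAct Q P g (compMk Q P z) = compLeftAct Q P k (compMk Q P z) := by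
      rw [compLeftAct_mk z hg, compLeftAct_mk z hk]
      congr 1
      exact Subtype.ext (Prod.ext e rfl)
    have h2 : G.mul g (τ (compMk Q P z)) = G.mul k (τ (compMk Q P z)) := by
      rw [← hl' g (compMk Q P z) hg, ← hl' k (compMk Q P z) hk, h1]
    have ht : G.t (τ (compMk Q P z)) = P.proj p := hp' _
    have key : ∀ {l : G.arr}, G.s l = P.proj p →
        G.mul (G.mul l (τ (compMk Q P z))) (G.inv (τ (compMk Q P z))) = l := by
      intro l hl
      rw [G.mul_assoc _ _ _ (hl.trans ht.symm) (G.t_inv _).symm, G.mul_inv, ht, ← hl, G.mul_unit]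
    rw [← key hg, h2, key hk]
  have hex : ∀ w : P.space × P.space, ∃ g : G.arr, P.mom w.1 = P.mom w.2 →
      G.s g = P.proj w.2 ∧ P.left.act g w.2 = w.1 := by
    intro w
    by_cases hw : P.mom w.1 = P.mom w.2
    · obtain ⟨q, hq⟩ := Q.principal.surjective (P.mom w.2)
      exact ⟨_, fun _ => hdiv (hw.trans hq.symm) hq.symm⟩
    -- Arbitrary value off the fibred product, so that `δ` is defined on all pairs.
    · exact ⟨G.unit (P.proj w.1), fun h => absurd h hw⟩
  choose δ hδ using hex
  refine ⟨mom_surjective_of_isomorphic h₂, mom_submersion_of_isomorphic hQ h₂, P.mom_left,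
    P.left.act_smooth.prodMk contMDiffOn_snd, fun w => (δ w, w.2), ?_, fun z hz =>
      P.mom_left _ _ hz, fun w hw => (hδ w hw).1, ?_, fun w hw => Prod.ext (hδ w hw).2 rfl⟩
  -- The chosen `δ` carries no smoothness of its own. Near `w₀` the auxiliary point is `σ (P.mom
  -- w.2)`, smooth in `w`, and freeness (`hinj`) identifies `δ` with the resulting explicit product
  -- of values of `τ`.
  · refine ContMDiffOn.prodMk (contMDiffOn_of_locally_contMDiffOn fun w₀ hw₀ => ?_) contMDiffOn_snd
    obtain ⟨q₀, hq₀⟩ := Q.principal.surjective (P.mom w₀.2)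
    obtain ⟨O, σ, hO, hxO, hσ, -, hσO⟩ := exists_section Q.principal.submersion q₀
    rw [hq₀] at hxO
    have hmc : ContMDiff (P.space.I.prod P.space.I) H.obj.I ∞
        (fun w : P.space × P.space => P.mom w.2) := P.right.momentum_smooth.comp contMDiff_snd
    refine ⟨(fun w => P.mom w.2) ⁻¹' O, hO.preimage hmc.continuous, hxO, ?_⟩
    have hσ' : ContMDiffOn (P.space.I.prod P.space.I) Q.space.I ∞
        (fun w : P.space × P.space => σ (P.mom w.2))
        ({w : P.space × P.space | P.mom w.1 = P.mom w.2} ∩ (fun w => P.mom w.2) ⁻¹' O) :=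
      hσ.comp hmc.contMDiffOn fun w hw => hw.2
    let r₀ : CompSpace Q P := compMk Q P ⟨(w₀.2, q₀), hq₀.symm⟩
    have e1 : ∀ w ∈ ({w : P.space × P.space | P.mom w.1 = P.mom w.2} ∩
        (fun w => P.mom w.2) ⁻¹' O), P.mom w.1 = Q.proj (σ (P.mom w.2)) := fun w hw =>
      Eq.trans hw.1 (hσO _ hw.2).symm
    have e2 : ∀ w ∈ ({w : P.space × P.space | P.mom w.1 = P.mom w.2} ∩
        (fun w => P.mom w.2) ⁻¹' O), P.mom w.2 = Q.proj (σ (P.mom w.2)) := fun w hw =>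
      (hσO _ hw.2).symm
    have s1 := τ.contMDiff.comp_contMDiffOn
      ((compTo_smooth Q P r₀).comp (contMDiffOn_fst.prodMk hσ') e1)
    have s2 := τ.contMDiff.comp_contMDiffOn
      ((compTo_smooth Q P r₀).comp (contMDiffOn_snd.prodMk hσ') e2)
    refine (G.mul_smooth.comp (s1.prodMk (G.inv_smooth.comp_contMDiffOn s2)) ?_).congr ?_
    · intro w hw
      change G.s (τ (compTo Q P r₀ (w.1, σ (P.mom w.2)))) =
        G.t (G.inv (τ (compTo Q P r₀ (w.2, σ (P.mom w.2)))))
      rw [compTo_of_mem Q P r₀ (e1 w hw), compTo_of_mem Q P r₀ (e2 w hw), G.t_inv, hm', hm']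
      rfl
    · intro w hw
      change δ w = G.mul (τ (compTo Q P r₀ (w.1, σ (P.mom w.2))))
        (G.inv (τ (compTo Q P r₀ (w.2, σ (P.mom w.2)))))
      rw [compTo_of_mem Q P r₀ (e1 w hw), compTo_of_mem Q P r₀ (e2 w hw)]
      obtain ⟨h3, h4⟩ := hdiv (e1 w hw) (e2 w hw)
      exact hinj (hδ w hw.1).1 h3 ((hδ w hw.1).2.trans h4.symm)
  · rintro ⟨g, p⟩ hz
    have hz' : G.s g = P.proj p := hz
    obtain ⟨h3, h4⟩ := hδ (P.left.act g p, p) (P.mom_left _ _ hz')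
    exact Prod.ext (hinj h3 hz' h4) rfl

end Invertible

end HilsumSkandalis

end

theorem mainTheorem11 {G H : HilsumSkandalis.LieGroupoid.{u}}
    (P : HilsumSkandalis.GenMorphism G H) :
    P.IsMorita ↔ ∃ Q : HilsumSkandalis.GenMorphism H G,
      (Q.comp P).Isomorphic (HilsumSkandalis.unitMorphism G) ∧
      (P.comp Q).Isomorphic (HilsumSkandalis.unitMorphism H) := by
  refine ⟨fun hP => ⟨P.op hP, P.op_comp_isomorphic hP, ?_⟩,
    fun ⟨_, h₁, h₂⟩ => HilsumSkandalis.GenMorphism.isMorita_of_isomorphic h₁ h₂⟩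
  -- The remaining isomorphism is the first one for `P.op hP`, whose own opposite is `P`.
  have h := (P.op hP).op_comp_isomorphic (P.op_isMorita hP)
  rwa [P.op_op hP] at h
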